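/- Let $\mathbb{D}$ be the open unit disk and let $0\le s<r<1$, $\lambda,\mu\in\mathbb{C}$ with $|\lambda|<1$, $|\mu|<1$. Let $\mathcal{H}_0(r,s,\lambda,\mu)$ be the set of all analytic $f:\mathbb{D}\to\mathbb{D}$ with $f(0)=0$, $f(r)=s$, $$f'(r)=\frac{s}{r}+\frac{r^2-s^2}{r(1-r^2)}\lambda,\qquad f''(r)=\frac{2(r^2-s^2)}{r^2(1-r^2)^2}\lambda(1-s\lambda)+\frac{2(r^2-s^2)}{r(1-r^2)^2}(1-|\lambda|^2)\mu,$$ and let $V(r,s,\lambda,\mu)=\{f^{(4)}(r): f\in\mathcal{H}_0(r,s,\lambda,\mu)\}$. Put $$A=\frac{24(r^2-s^2)}{r^4(1-r^2)^4},\quad D=1+2r^2-2s\lambda-2r\overline{\lambda}\mu,\quad C=r^2(1-|\lambda|^2)(1-|\mu|^2)D,$$ $$\begin{aligned}B&=\lambda r^6-s^3\lambda^4-3s^2\lambda^2q+(1-r^2-2s\lambda)\bigl(\lambda(s\lambda-r^2)^2+r\mu(1-|\lambda|^2)(2r^2-2s\lambda-r\overline{\lambda}\mu)\bigr)\\&\quad-sq^2+r^3(1-|\lambda|^2)(\overline{\lambda}^2\mu^3+3r^2\mu-3r\overline{\lambda}\mu^2),\qquad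 q=-s\lambda^2+r^2\lambda+r\mu(1-|\lambda|^2).\end{aligned}$$ Then $V(r,s,\lambda,\mu)$ is a convex closed domain (a closed convex set that is the closure of its non-empty connected interior), its boundary $\partial V(r,s,\lambda,\mu)$ is a Jordan curve, and its interior is the region enclosed by this curve. Suppose moreover that $D\ne0$, and put $$\eta=\frac{r\overline{\mu}}{D},\qquad t=\frac{r}{|D|},\qquad c(\zeta)=\zeta(1-\eta\zeta),\qquad \rho(\zeta)=t(1-|\zeta|^2).$$ For each $\theta\in\mathbb{R}$ with $|te^{i\theta}-\overline{\eta}|\ge 2(t^2-|\eta|^2)$ the equation $|xe^{i\theta}-\overline{\eta}|=2(x^2-|\eta|^2)$, $x>|\eta|$, has a unique solution $x$; denote it by $t_\theta$. For all other $\theta$ let $t_\theta=t$. Set $$\zeta_\theta=\frac{t_\theta e^{i\theta}-\overline{\eta}}{2(t_\theta^2-|\eta|^2)}.$$ Then $\zeta_\theta\in\overline{\mathbb{D}}$ for all $\theta$, and a parametrization $(-\pi,\pi]\ni\theta\mapsto\gamma(\theta)$ of the Jordan curve $\partial V(r,s,\lambda,\mu)$ (continuous and $2\pi$-periodic on $\mathbb{R}$,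 and a bijection from $(-\pi,\pi]$ onto the curve) is given as follows. (i) If $t+|\eta|\le\frac12$, then $|te^{i\theta}-\overline{\eta}|\ge 2(t^2-|\eta|^2)$ for all $\theta\in\mathbb{R}$, and $\gamma(\theta)=A\bigl(B+C\,c(\zeta_\theta)\bigr)$. (ii) If $t-|\eta|\ge\frac12$, then $|te^{i\theta}-\overline{\eta}|\le 2(t^2-|\eta|^2)$ for all $\theta\in\mathbb{R}$, and $\gamma(\theta)=A\bigl(B+C(c(\zeta_\theta)+\rho(\zeta_\theta)e^{i\theta})\bigr)$. (iii) If $t+|\eta|>\frac12$ and $t-|\eta|<\frac12$, then $\gamma(\theta)=A\bigl(B+C(c(\zeta_\theta)+\rho(\zeta_\theta)e^{i\theta})\bigr)$ when $|te^{i\theta}-\overline{\eta}|<2(t^2-|\eta|^2)$, and $\gamma(\theta)=A\bigl(B+C\,c(\zeta_\theta)\bigr)$ when $|te^{i\theta}-\overline{\eta}|\ge 2(t^2-|\eta|^2)$. -/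

import Mathlib

open Set Metric
open scoped ComplexConjugate

namespace FourthDerivative

/-- The class of analytic self-maps `f` of the open unit disk with `f 0 = 0`. Only the restriction
of `f` to the disk is relevant. -/
def selfMaps₀ : Set (ℂ → ℂ) :=
  {f | DifferentiableOn ℂ f (ball 0 1) ∧ MapsTo f (ball 0 1) (ball 0 1) ∧ f 0 = 0}

noncomputable section

/-- Centre of the disk of values of `f'(r)` when `f(r) = s`. -/
def c₁ (r s : ℝ) : ℂ := (s : ℂ) / r

/-- Radius of the disk of values of `f'(r)` when `f(r) = s`. -/
def ρ₁ (r s : ℝ) : ℝ := (r ^ 2 - s ^ 2) / (r * (1 - r ^ 2))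

/-- Centre of the disk of values of `f''(r)`. -/
def c₂ (r s : ℝ) (lam : ℂ) : ℂ :=
  2 * ((r : ℂ) ^ 2 - s ^ 2) / (r ^ 2 * (1 - r ^ 2) ^ 2) * lam * (1 - s * lam)

/-- Radius of the disk of values of `f''(r)`. -/
def ρ₂ (r s : ℝ) (lam : ℂ) : ℝ :=
  2 * (r ^ 2 - s ^ 2) / (r * (1 - r ^ 2) ^ 2) * (1 - ‖lam‖ ^ 2)

/-- The class `H₀(r, s, lam, mu)`. -/
def H₀ (r s : ℝ) (lam mu : ℂ) : Set (ℂ → ℂ) :=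
  {f | f ∈ selfMaps₀ ∧ f r = s ∧ deriv f r = c₁ r s + ρ₁ r s * lam ∧
    iteratedDeriv 2 f r = c₂ r s lam + ρ₂ r s lam * mu}

/-- The variability region `V(r, s, lam, mu)` of the fourth derivative at `r`. -/
def V (r s : ℝ) (lam mu : ℂ) : Set ℂ :=
  {w | ∃ f ∈ H₀ r s lam mu, w = iteratedDeriv 4 f r}

/-- The constant `A`. -/
def A (r s : ℝ) : ℝ := 24 * (r ^ 2 - s ^ 2) / (r ^ 4 * (1 - r ^ 2) ^ 4)

/-- The constant `B`. -/
def B (r s : ℝ) (lam mu : ℂ) : ℂ :=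
  lam * r ^ 6 - s ^ 3 * lam ^ 4
    - 3 * s ^ 2 * lam ^ 2 * (-s * lam ^ 2 + r ^ 2 * lam + r * mu * (1 - ‖lam‖ ^ 2))
    + (1 - r ^ 2 - 2 * s * lam) * (lam * (s * lam - r ^ 2) ^ 2
        + r * mu * (1 - ‖lam‖ ^ 2) * (2 * r ^ 2 - 2 * s * lam - r * conj lam * mu))
    - s * (-s * lam ^ 2 + r ^ 2 * lam + r * mu * (1 - ‖lam‖ ^ 2)) ^ 2
    + r ^ 3 * (1 - ‖lam‖ ^ 2) *
        (conj lam ^ 2 * mu ^ 3 + 3 * r ^ 2 * mu - 3 * r * conj lam * mu ^ 2)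

/-- The common denominator `1 + 2r² - 2 s lam - 2 r conj(lam) mu` of `η` and `t`. -/
def D (r s : ℝ) (lam mu : ℂ) : ℂ :=
  1 + 2 * r ^ 2 - 2 * s * lam - 2 * r * conj lam * mu

/-- The constant `C`. -/
def C (r s : ℝ) (lam mu : ℂ) : ℂ :=
  r ^ 2 * (1 - ‖lam‖ ^ 2) * (1 - ‖mu‖ ^ 2) * D r s lam mu

/-- The parameter `η`. -/
def η (r s : ℝ) (lam mu : ℂ) : ℂ := r * conj mu / D r s lam mu

/-- The parameter `t`. -/
def t (r s : ℝ) (lam mu : ℂ) : ℝ := r / ‖D r s lam mu‖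

/-- `c(ζ) = ζ (1 - η ζ)`. -/
def c (η ζ : ℂ) : ℂ := ζ * (1 - η * ζ)

/-- `ρ(ζ) = t (1 - |ζ|²)`. -/
def ρ (t : ℝ) (ζ : ℂ) : ℝ := t * (1 - ‖ζ‖ ^ 2)

/-- `|x e^{iθ} - conj η|`. -/
def lhs (η : ℂ) (x θ : ℝ) : ℝ := ‖(x : ℂ) * Complex.exp (θ * Complex.I) - conj η‖

/-- `2 (x² - |η|²)`. -/
def rhs (η : ℂ) (x : ℝ) : ℝ := 2 * (x ^ 2 - ‖η‖ ^ 2)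

/-- `x` is the number `t_θ`: if `|t e^{iθ} - conj η| ≥ 2 (t² - |η|²)`, then `x` is a solution of
`|x e^{iθ} - conj η| = 2 (x² - |η|²)`, `x > |η|`; otherwise `x = t`. -/
def IsTTheta (η : ℂ) (t θ x : ℝ) : Prop :=
  (rhs η t ≤ lhs η t θ → ‖η‖ < x ∧ lhs η x θ = rhs η x) ∧
  (¬ rhs η t ≤ lhs η t θ → x = t)

/-- `ζ_θ`, where `x` is `t_θ`. -/
def zetaTheta (η : ℂ) (x θ : ℝ) : ℂ :=
  ((x : ℂ) * Complex.exp (θ * Complex.I) - conj η) / (2 * ((x : ℂ) ^ 2 - ‖η‖ ^ 2))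

/-- The point `A (B + C c(ζ))`. -/
def centrePoint (r s : ℝ) (lam mu ζ : ℂ) : ℂ :=
  A r s * (B r s lam mu + C r s lam mu * c (η r s lam mu) ζ)

/-- The point `A (B + C (c(ζ) + ρ(ζ) e^{iθ}))`. -/
def circlePoint (r s : ℝ) (lam mu ζ : ℂ) (θ : ℝ) : ℂ :=
  A r s * (B r s lam mu + C r s lam mu *
    (c (η r s lam mu) ζ + ρ (t r s lam mu) ζ * Complex.exp (θ * Complex.I)))

end

/-- A Jordan curve in the plane: the image of an injective continuous map of the circle. -/
def IsJordanCurve (J : Set ℂ) : Prop :=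
  ∃ g : Circle → ℂ, Continuous g ∧ Function.Injective g ∧ range g = J

/-- The region enclosed by `J`: the points off `J` that lie in a bounded component of the
complement of `J`. -/
def enclosedBy (J : Set ℂ) : Set ℂ :=
  {p | p ∉ J ∧ Bornology.IsBounded (connectedComponentIn Jᶜ p)}

/-- `K` is a convex closed domain (the closure of its non-empty connected interior) whose
boundary is a Jordan curve that encloses its interior. -/
structure IsConvexClosedJordanDomain (K : Set ℂ) : Prop where
  convex : Convex ℝ K
  isClosed : IsClosed K
  isConnected_interior : IsConnected (interior K)
  closure_interior : closure (interior K) = K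
  isJordanCurve_frontier : IsJordanCurve (frontier K)
  interior_eq : interior K = enclosedBy (frontier K)

/-- `(-π, π] ∋ θ ↦ γ θ` is a parametrization of the simple closed curve `J`: `γ` is continuous,
closes up (`2π`-periodic), and takes each point of `J`, and no other point, exactly once on
`(-π, π]`. -/
structure IsParametrization (γ : ℝ → ℂ) (J : Set ℂ) : Prop where
  continuous : Continuous γ
  periodic : Function.Periodic γ (2 * Real.pi)
  bijOn : BijOn γ (Ioc (-Real.pi) Real.pi) J

end FourthDerivative

namespace FourthDerivative

open Filter Topology

/-! ### Compact convex bodies in the plane -/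

/-! Write `f = z g` and run the Schur algorithm at `r` three times: `g → g₁ → g₂ → g₃`. Prescribing
`f`, `f'`, `f''` at `r` amounts to `g r = s / r`, `g₁ r = lam`, `g₂ r = mu`, while `g₃` is an
arbitrary analytic map into the closed disk. Comparing Taylor coefficients shows that the fourth
derivative is an affine function of `D ζ - r conj(mu) ζ² + r (1 - r²) g₃'(r)` with `ζ = g₃ r`, and
by Schwarz–Pick `(1 - r²) g₃'(r)` ranges over exactly the disk of radius `1 - |ζ|²`. Hence `V` is an
affine image of a union of disks, `discUnion` (`V_eq_image`).

This union is convex because the quadratic term of the centre is dominated by the concavity of the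
radius, as `|r conj(mu)| < r` (`convex_discUnion`). For the boundary, divide by `D` and maximize `Re
(e^{-iθ} c(ζ)) + t (1 - |ζ|²)` over the closed disk. Since `|η| < t`, this is strictly concave. Its
free critical point is `ζ_θ` with `t_θ = t`; if that point leaves the open disk, the constraint `|ζ|
= 1` is active and `t_θ - t` is its Lagrange multiplier (`support_eq`, `IsTTheta.support_lt`). So
each direction exposes one point, distinct directions expose distinct points, and
`isParametrization_of_exposed` applies. The formulas of the three cases agree because `ρ` vanishes
on `|ζ| = 1`. -/

theorem enclosedBy_frontier {K : Set ℂ} (hK : IsCompact K) (hc : Convex ℝ K)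
    (hi : (interior K).Nonempty) : enclosedBy (frontier K) = interior K := by
  ext p
  constructor
  · rintro ⟨hp, hb⟩
    by_contra hpi
    have hpK : p ∉ K := fun h => hp ⟨subset_closure h, hpi⟩
    obtain ⟨x₀, hx₀⟩ := hi
    have hx₀K := interior_subset hx₀
    have hne : p - x₀ ≠ 0 := fun h => hpK (by rwa [sub_eq_zero.1 h])
    set g : ℝ → ℂ := fun a => p + (a : ℂ) * (p - x₀) with hg
    have hray : ∀ a ∈ Ici (0 : ℝ), g a ∈ (frontier K)ᶜ := by
      intro a ha hmem
      have hmem' : g a ∈ K := hK.isClosed.frontier_subset hmem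
      apply hpK
      have ha0 : (0 : ℝ) ≤ a := ha
      have h1 : 0 < 1 + a := by linarith
      -- The ray leaves `p` away from `x₀`, so `p` lies between `g a` and `x₀`; if `g a` were in
      -- `K`, convexity would put `p` in `K`.
      have := hc hmem' hx₀K (a := 1 / (1 + a)) (b := a / (1 + a)) (by positivity) (by positivity)
        (by field_simp)
      convert this using 1
      have h2 : (1 + a : ℂ) ≠ 0 := by exact_mod_cast h1.ne'
      simp only [hg, Complex.real_smul]
      push_cast
      field_simp
      ring
    have hpre : IsPreconnected (g '' Ici 0) :=
      isPreconnected_Ici.image _ (by fun_prop)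
    have hsub : g '' Ici 0 ⊆ connectedComponentIn (frontier K)ᶜ p :=
      hpre.subset_connectedComponentIn ⟨0, by simp, by simp [hg]⟩
        (by rintro _ ⟨a, ha, rfl⟩; exact hray a ha)
    obtain ⟨R, hR⟩ := (hb.subset hsub).exists_norm_le
    have hpos : 0 < ‖p - x₀‖ := norm_pos_iff.2 hne
    have hR0 : 0 ≤ R := (norm_nonneg _).trans (hR _ ⟨0, by simp, rfl⟩)
    set a : ℝ := (R + ‖p‖ + 1) / ‖p - x₀‖ with ha
    have ha0 : 0 ≤ a := by positivity
    have h1 := hR _ ⟨a, ha0, rfl⟩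
    have h2 : ‖(a : ℂ) * (p - x₀)‖ = R + ‖p‖ + 1 := by
      rw [norm_mul, Complex.norm_real, Real.norm_of_nonneg ha0, ha]
      field_simp
    have h3 : ‖(a : ℂ) * (p - x₀)‖ ≤ ‖g a‖ + ‖p‖ := by
      have : (a : ℂ) * (p - x₀) = g a - p := by simp [hg]
      rw [this]
      exact norm_sub_le _ _
    linarith
  · intro hp
    refine ⟨fun h => h.2 hp, hK.isBounded.subset ?_⟩
    intro x hx
    by_contra hxK
    have hpre : IsPreconnected (connectedComponentIn (frontier K)ᶜ p) :=
      isPreconnected_connectedComponentIn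
    have hsub := connectedComponentIn_subset (frontier K)ᶜ p
    have hpm : p ∈ connectedComponentIn (frontier K)ᶜ p :=
      mem_connectedComponentIn (fun h => h.2 hp)
    -- Off the frontier, `interior K` and `Kᶜ` are disjoint open sets that cover, so a component
    -- cannot meet both.
    obtain ⟨y, hy, hy1, hy2⟩ := hpre (interior K) Kᶜ isOpen_interior hK.isClosed.isOpen_compl
      (fun y hy => by
        by_cases hyK : y ∈ K
        · left
          by_contra hyi
          exact hsub hy ⟨subset_closure hyK, hyi⟩
        · right; exact hyK)
      ⟨p, hpm, hp⟩ ⟨x, hx, hxK⟩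
    exact hy2 (interior_subset hy1)

theorem isConvexClosedJordanDomain_of_isCompact {K : Set ℂ} (hK : IsCompact K)
    (hc : Convex ℝ K) (hi : (interior K).Nonempty) : IsConvexClosedJordanDomain K where
  convex := hc
  isClosed := hK.isClosed
  isConnected_interior := ⟨hi, hc.interior.isPreconnected⟩
  closure_interior := by
    rw [hc.closure_interior_eq_closure_of_nonempty_interior hi, hK.isClosed.closure_eq]
  isJordanCurve_frontier := by
    obtain ⟨h, -, -, hf⟩ :=
      exists_homeomorph_image_interior_closure_frontier_eq_unitBall hc hi hK.isBounded
    refine ⟨fun z => h.symm z, by fun_prop, fun z w hzw => Subtype.ext (h.symm.injective hzw), ?_⟩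
    have : (range fun z : Circle => (z : ℂ)) = sphere (0 : ℂ) 1 := by
      ext z
      simp only [mem_range, mem_sphere_zero_iff_norm]
      exact ⟨fun ⟨y, hy⟩ => hy ▸ y.norm_coe, fun h => ⟨⟨z, mem_sphere_zero_iff_norm.2 h⟩, rfl⟩⟩
    rw [range_comp' h.symm, this, ← hf, ← image_comp]
    simp
  interior_eq := (enclosedBy_frontier hK hc hi).symm

/-- A nonzero real linear functional on `ℂ` is a positive multiple of
`z ↦ Re (e^{-iθ} z)` for some `θ`. -/
theorem exists_dual_eq (f : StrongDual ℝ ℂ) (hf : f ≠ 0) :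
    ∃ (R θ : ℝ), 0 < R ∧ ∀ z, f z = R * (conj (Complex.exp (θ * Complex.I)) * z).re := by
  set v : ℂ := ⟨f 1, f Complex.I⟩ with hv
  have hfv : ∀ z, f z = (conj v * z).re := by
    intro z
    have hz : z = z.re • (1 : ℂ) + z.im • Complex.I := by simp
    conv_lhs => rw [hz]
    rw [map_add, map_smul, map_smul]
    simp [hv]
    ring
  have hv0 : v ≠ 0 := by
    rintro h
    apply hf
    ext
    simp [hfv, h]
  refine ⟨‖v‖, Complex.arg v, norm_pos_iff.2 hv0, fun z => ?_⟩
  rw [hfv]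
  conv_lhs => rw [← Complex.norm_mul_exp_arg_mul_I v]
  rw [map_mul, Complex.conj_ofReal, mul_assoc, Complex.re_ofReal_mul]

theorem exp_mul_I_injOn {θ θ' : ℝ} (hθ : θ ∈ Ioc (-Real.pi) Real.pi)
    (hθ' : θ' ∈ Ioc (-Real.pi) Real.pi)
    (h : Complex.exp (θ * Complex.I) = Complex.exp (θ' * Complex.I)) : θ = θ' := by
  rw [← Complex.arg_cos_add_sin_mul_I hθ, ← Complex.arg_cos_add_sin_mul_I hθ',
    ← Complex.exp_mul_I, ← Complex.exp_mul_I, h]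

theorem exp_add_two_pi_mul_I (θ : ℝ) :
    Complex.exp (((θ + 2 * Real.pi : ℝ) : ℂ) * Complex.I) = Complex.exp (θ * Complex.I) := by
  have := Complex.exp_periodic (θ * Complex.I)
  rw [← this]
  push_cast
  ring_nf

/-- If every direction `e^{iθ}` exposes exactly one point `γ θ` of a convex body, and distinct
directions expose distinct points, then `γ` parametrizes the boundary. -/
theorem isParametrization_of_exposed {K : Set ℂ} (hK : IsCompact K) (hc : Convex ℝ K)
    (hi : (interior K).Nonempty) {γ : ℝ → ℂ} (hmem : ∀ θ, γ θ ∈ K)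
    (hmax : ∀ θ : ℝ, ∀ k ∈ K, k ≠ γ θ → (conj (Complex.exp (θ * Complex.I)) * k).re <
      (conj (Complex.exp (θ * Complex.I)) * γ θ).re)
    (hinj : ∀ θ θ' : ℝ, γ θ = γ θ' →
      Complex.exp (θ * Complex.I) = Complex.exp (θ' * Complex.I)) :
    IsParametrization γ (frontier K) := by
  have hle : ∀ θ : ℝ, ∀ k ∈ K, (conj (Complex.exp (θ * Complex.I)) * k).re ≤
      (conj (Complex.exp (θ * Complex.I)) * γ θ).re := by
    intro θ k hk
    rcases eq_or_ne k (γ θ) with rfl | h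
    · exact le_rfl
    · exact (hmax θ k hk h).le
  have huniq : ∀ θ : ℝ, ∀ x ∈ K, (∀ k ∈ K, (conj (Complex.exp (θ * Complex.I)) * k).re ≤
      (conj (Complex.exp (θ * Complex.I)) * x).re) → x = γ θ := by
    intro θ x hx h
    by_contra hne
    exact absurd (hmax θ x hx hne) (not_lt.2 (h _ (hmem θ)))
  have hcong : ∀ θ θ' : ℝ, Complex.exp (θ * Complex.I) = Complex.exp (θ' * Complex.I) →
      γ θ = γ θ' := by
    intro θ θ' h
    exact huniq θ' _ (hmem θ) (fun k hk => h ▸ hle θ k hk)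
  refine ⟨?_, fun θ => hcong _ _ (exp_add_two_pi_mul_I θ), ?_, ?_, ?_⟩
  · rw [continuous_iff_continuousAt]
    intro θ₀
    -- By compactness it is enough to identify cluster points: a limit of maximizers maximizes in
    -- the limiting direction, and that maximizer is unique.
    refine hK.tendsto_nhds_of_unique_mapClusterPt (Eventually.of_forall hmem) ?_
    intro x hx hcl
    obtain ⟨U, hU, hlim⟩ := mapClusterPt_iff_ultrafilter.1 hcl
    refine huniq θ₀ x hx fun k hk => ?_
    have hexp : Tendsto (fun θ : ℝ => conj (Complex.exp (θ * Complex.I))) U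
        (𝓝 (conj (Complex.exp (θ₀ * Complex.I)))) := by
      have : Continuous fun θ : ℝ => conj (Complex.exp (θ * Complex.I)) := by fun_prop
      exact (this.tendsto θ₀).mono_left hU
    refine le_of_tendsto_of_tendsto
      ((Complex.continuous_re.tendsto _).comp (hexp.mul_const k))
      ((Complex.continuous_re.tendsto _).comp (hexp.mul hlim))
      (Eventually.of_forall fun θ => hle θ k hk)
  · intro θ _
    refine ⟨subset_closure (hmem θ), fun hint => ?_⟩
    obtain ⟨ε, hε, hball⟩ := Metric.isOpen_iff.1 isOpen_interior _ hint
    set u := Complex.exp (θ * Complex.I) with hu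
    have hnu : ‖u‖ = 1 := Complex.norm_exp_ofReal_mul_I θ
    -- An interior point could be pushed further in the direction `u`, contradicting maximality.
    have hmem' : γ θ + (ε / 2 : ℝ) * u ∈ K := by
      refine interior_subset (hball ?_)
      rw [mem_ball, dist_eq_norm, add_sub_cancel_left, norm_mul, hnu, Complex.norm_real,
        Real.norm_of_nonneg (by positivity)]
      linarith
    have h1 := hle θ _ hmem'
    rw [← hu, mul_add, mul_left_comm, mul_comm (conj u) u, Complex.mul_conj, Complex.normSq_eq_norm_sq,
      hnu] at h1
    simp only [Complex.add_re, one_pow, Complex.ofReal_one, mul_one, Complex.ofReal_re] at h1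
    linarith
  · intro θ hθ θ' hθ' h
    exact exp_mul_I_injOn hθ hθ' (hinj θ θ' h)
  · intro k hk
    have hkK : k ∈ K := hK.isClosed.frontier_subset hk
    obtain ⟨f, hf0, hf⟩ := geometric_hahn_banach_of_nonempty_interior_point hc hk.2 hi
    obtain ⟨R, θ, hR, hfθ⟩ := exists_dual_eq f hf0
    set u := Complex.exp (θ * Complex.I) with hu
    have hnu : ‖u‖ = 1 := Complex.norm_exp_ofReal_mul_I θ
    refine ⟨Complex.arg u, Complex.arg_mem_Ioc u, ?_⟩
    have harg : Complex.exp (Complex.arg u * Complex.I) = Complex.exp (θ * Complex.I) := by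
      have := Complex.norm_mul_exp_arg_mul_I u
      rw [hnu] at this
      simpa using this
    rw [hcong _ _ harg]
    refine (huniq θ k hkK fun k' hk' => ?_).symm
    have := hf k' hk'
    rw [hfθ, hfθ] at this
    exact le_of_mul_le_mul_left this hR

/-! ### A union of disks with quadratic centres and radii -/

/-- The union over the closed unit disk of the closed disks with centre `a ζ - b ζ²` and radius
`t (1 - |ζ|²)`. -/
def discUnion (a b : ℂ) (t : ℝ) : Set ℂ :=
  {k | ∃ ζ w : ℂ, ‖ζ‖ ≤ 1 ∧ ‖w‖ ≤ 1 ∧ k = a * ζ - b * ζ ^ 2 + t * (1 - ‖ζ‖ ^ 2) * w}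

theorem isCompact_discUnion (a b : ℂ) (t : ℝ) : IsCompact (discUnion a b t) := by
  have : discUnion a b t = (fun p : ℂ × ℂ => a * p.1 - b * p.1 ^ 2 + t * (1 - ‖p.1‖ ^ 2) * p.2) ''
      (closedBall 0 1 ×ˢ closedBall 0 1) := by
    ext k
    simp only [discUnion, mem_ofPred_eq, mem_image, mem_prod, mem_closedBall_zero_iff, Prod.exists]
    constructor
    · rintro ⟨ζ, w, h1, h2, rfl⟩
      exact ⟨ζ, w, ⟨h1, h2⟩, rfl⟩
    · rintro ⟨ζ, w, ⟨h1, h2⟩, rfl⟩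
      exact ⟨ζ, w, h1, h2, rfl⟩
  rw [this]
  exact ((isCompact_closedBall _ _).prod (isCompact_closedBall _ _)).image (by fun_prop)

theorem interior_discUnion_nonempty (a b : ℂ) {t : ℝ} (ht : 0 < t) :
    (interior (discUnion a b t)).Nonempty := by
  refine ⟨0, mem_interior.2 ⟨ball 0 t, ?_, isOpen_ball, mem_ball_self ht⟩⟩
  intro k hk
  rw [mem_ball_zero_iff] at hk
  refine ⟨0, k / t, by simp, ?_, ?_⟩
  · rw [norm_div, Complex.norm_real, Real.norm_of_nonneg ht.le]
    exact (div_le_one ht).2 hk.le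
  · have : (t : ℂ) ≠ 0 := by exact_mod_cast ht.ne'
    simp
    field_simp

theorem mem_discUnion_iff {a b k : ℂ} {t : ℝ} (ht : 0 < t) : k ∈ discUnion a b t ↔
    ∃ ζ : ℂ, ‖ζ‖ ≤ 1 ∧ ‖k - (a * ζ - b * ζ ^ 2)‖ ≤ t * (1 - ‖ζ‖ ^ 2) := by
  constructor
  · rintro ⟨ζ, w, hζ, hw, rfl⟩
    refine ⟨ζ, hζ, ?_⟩
    have h : 0 ≤ t * (1 - ‖ζ‖ ^ 2) :=
      mul_nonneg ht.le (by nlinarith [norm_nonneg ζ])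
    have h2 : (t * (1 - ‖ζ‖ ^ 2) : ℂ) = ((t * (1 - ‖ζ‖ ^ 2) : ℝ) : ℂ) := by push_cast; rfl
    rw [add_sub_cancel_left, h2, norm_mul, Complex.norm_real, Real.norm_of_nonneg h]
    exact mul_le_of_le_one_right h hw
  · rintro ⟨ζ, hζ, hk⟩
    have h : 0 ≤ t * (1 - ‖ζ‖ ^ 2) := (norm_nonneg _).trans hk
    have h2 : (t * (1 - ‖ζ‖ ^ 2) : ℂ) = ((t * (1 - ‖ζ‖ ^ 2) : ℝ) : ℂ) := by push_cast; rfl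
    -- For `|ζ| = 1` the disk degenerates to its centre, and any `w` in the unit disk serves.
    rcases h.eq_or_lt with h0 | hpos
    · refine ⟨ζ, 0, hζ, by simp, ?_⟩
      rw [← h0] at hk
      simpa using sub_eq_zero.1 (norm_le_zero_iff.1 hk)
    · refine ⟨ζ, (k - (a * ζ - b * ζ ^ 2)) / ((t * (1 - ‖ζ‖ ^ 2) : ℝ) : ℂ), hζ, ?_, ?_⟩
      · rw [norm_div, Complex.norm_real, Real.norm_of_nonneg h]
        exact (div_le_one hpos).2 hk
      · have : ((t * (1 - ‖ζ‖ ^ 2) : ℝ) : ℂ) ≠ 0 := by exact_mod_cast hpos.ne'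
        rw [h2, mul_div_cancel₀ _ this]
        ring

/-- For a convex combination with weights `p`, `q`, the centre deviates from affinity by `p q b (ζ₁
- ζ₂)²`, while the radius gains `t p q |ζ₁ - ζ₂|²` by concavity; the gain absorbs the deviation. -/
theorem convex_discUnion {a b : ℂ} {t : ℝ} (hb : ‖b‖ < t) : Convex ℝ (discUnion a b t) := by
  have ht : 0 < t := (norm_nonneg b).trans_lt hb
  intro k₁ h₁ k₂ h₂ p q hp hq hpq
  rw [mem_discUnion_iff ht] at *
  obtain ⟨ζ₁, hζ₁, hk₁⟩ := h₁
  obtain ⟨ζ₂, hζ₂, hk₂⟩ := h₂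
  have hq' : q = 1 - p := by linarith
  have hid : p * ‖ζ₁‖ ^ 2 + q * ‖ζ₂‖ ^ 2 - ‖p • ζ₁ + q • ζ₂‖ ^ 2 = p * q * ‖ζ₁ - ζ₂‖ ^ 2 := by
    simp only [← Complex.normSq_eq_norm_sq, Complex.normSq_apply, Complex.add_re, Complex.add_im,
      Complex.sub_re, Complex.sub_im, Complex.real_smul, Complex.re_ofReal_mul,
      Complex.im_ofReal_mul, hq']
    ring
  refine ⟨p • ζ₁ + q • ζ₂, ?_, ?_⟩
  · have := (convex_closedBall (0 : ℂ) 1) (x := ζ₁) (by simpa using hζ₁)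
      (y := ζ₂) (by simpa using hζ₂) hp hq hpq
    simpa only [mem_closedBall_zero_iff] using this
  have hsplit : p • k₁ + q • k₂ - (a * (p • ζ₁ + q • ζ₂) - b * (p • ζ₁ + q • ζ₂) ^ 2) =
      p • (k₁ - (a * ζ₁ - b * ζ₁ ^ 2)) + q • (k₂ - (a * ζ₂ - b * ζ₂ ^ 2)) -
        (p * q : ℝ) • (b * (ζ₁ - ζ₂) ^ 2) := by
    simp only [Complex.real_smul, hq']
    push_cast
    ring
  have hbound : ‖(p * q : ℝ) • (b * (ζ₁ - ζ₂) ^ 2)‖ ≤ t * (p * q * ‖ζ₁ - ζ₂‖ ^ 2) := by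
    rw [norm_smul, Real.norm_of_nonneg (by positivity), norm_mul, norm_pow]
    have : p * q * (‖b‖ * ‖ζ₁ - ζ₂‖ ^ 2) = ‖b‖ * (p * q * ‖ζ₁ - ζ₂‖ ^ 2) := by ring
    rw [this]
    exact mul_le_mul_of_nonneg_right hb.le (by positivity)
  rw [hsplit]
  refine (norm_sub_le _ _).trans ((add_le_add (norm_add_le _ _) hbound).trans ?_)
  rw [norm_smul, norm_smul, Real.norm_of_nonneg hp, Real.norm_of_nonneg hq, ← hid]
  have e1 := mul_le_mul_of_nonneg_left hk₁ hp
  have e2 := mul_le_mul_of_nonneg_left hk₂ hq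
  calc _ ≤ p * (t * (1 - ‖ζ₁‖ ^ 2)) + q * (t * (1 - ‖ζ₂‖ ^ 2)) +
        t * (p * ‖ζ₁‖ ^ 2 + q * ‖ζ₂‖ ^ 2 - ‖p • ζ₁ + q • ζ₂‖ ^ 2) := by linarith
    _ = t * ((p + q) - ‖p • ζ₁ + q • ζ₂‖ ^ 2) := by ring
    _ = _ := by rw [hpq]

/-! ### The maximizer `ζ_θ` -/

/-- The support functional of the disk with centre `c(ζ)` and radius `x (1 - |ζ|²)` in the
direction `u`. -/
noncomputable def support (η : ℂ) (x : ℝ) (u ζ : ℂ) : ℝ := (conj u * c η ζ).re + x * (1 - ‖ζ‖ ^ 2)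

theorem sq_sub_sq_norm_pos {η : ℂ} {x : ℝ} (hx : ‖η‖ < x) : 0 < x ^ 2 - ‖η‖ ^ 2 := by
  nlinarith [norm_nonneg η]

theorem ofReal_sq_sub_sq_norm_ne_zero {η : ℂ} {x : ℝ} (hx : ‖η‖ < x) :
    (x : ℂ) ^ 2 - (‖η‖ : ℂ) ^ 2 ≠ 0 := by
  exact_mod_cast (sq_sub_sq_norm_pos hx).ne'

theorem conj_mul_self_of_norm_eq_one {u : ℂ} (hu : ‖u‖ = 1) : conj u * u = 1 := by
  rw [mul_comm, Complex.mul_conj, Complex.normSq_eq_norm_sq, hu]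
  simp

/-- This is the critical point equation of `support η x u`, where `u = e^{iθ}`; together with its
conjugate it is a linear system whose solution is `zetaTheta`. -/
theorem mul_zetaTheta {η : ℂ} {x : ℝ} (hx : ‖η‖ < x) (θ : ℝ) :
    x * zetaTheta η x θ =
      Complex.exp (θ * Complex.I) * (1 / 2 - conj η * conj (zetaTheta η x θ)) := by
  have h0 := ofReal_sq_sub_sq_norm_ne_zero hx
  have hu := conj_mul_self_of_norm_eq_one (Complex.norm_exp_ofReal_mul_I θ)
  have hη : η * conj η = (‖η‖ : ℂ) ^ 2 := by
    rw [Complex.mul_conj, Complex.normSq_eq_norm_sq]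
    push_cast
    rfl
  unfold zetaTheta
  set u := Complex.exp (θ * Complex.I)
  simp only [map_div₀, map_sub, map_mul, map_pow, Complex.conj_ofReal, Complex.conj_conj,
    map_ofNat]
  field_simp
  linear_combination (x : ℂ) * conj η * hu - u * hη

theorem norm_zetaTheta {η : ℂ} {x : ℝ} (hx : ‖η‖ < x) (θ : ℝ) :
    ‖zetaTheta η x θ‖ = lhs η x θ / rhs η x := by
  have h : (2 * ((x : ℂ) ^ 2 - (‖η‖ : ℂ) ^ 2)) = ((rhs η x : ℝ) : ℂ) := by
    simp [rhs]
  have hr : 0 < rhs η x := mul_pos two_pos (sq_sub_sq_norm_pos hx)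
  rw [zetaTheta, h, norm_div, Complex.norm_real, Real.norm_of_nonneg hr.le, lhs]

/-- The exact second-order expansion at the critical point. The quadratic form is at least `(x -
|η|) |ζ - ζ_θ|²`, which makes the maximum strict. -/
theorem support_eq {η : ℂ} {x : ℝ} (hx : ‖η‖ < x) (θ : ℝ) (ζ : ℂ) :
    support η x (Complex.exp (θ * Complex.I)) ζ =
      support η x (Complex.exp (θ * Complex.I)) (zetaTheta η x θ) -
        ((conj (Complex.exp (θ * Complex.I)) * (η * (ζ - zetaTheta η x θ) ^ 2)).re +
          x * ‖ζ - zetaTheta η x θ‖ ^ 2) := by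
  have key := mul_zetaTheta hx θ
  have hu := Complex.norm_exp_ofReal_mul_I θ
  set u := Complex.exp (θ * Complex.I)
  set z := zetaTheta η x θ
  have h1 := congrArg Complex.re key
  have h2 := congrArg Complex.im key
  simp only [support, c, ← Complex.normSq_eq_norm_sq, Complex.normSq_apply]
  simp [pow_two] at h1 h2 ⊢
  linear_combination -2 * (ζ.re - z.re) * h1 - 2 * (ζ.im - z.im) * h2

theorem support_lt {η : ℂ} {x : ℝ} (hx : ‖η‖ < x) (θ : ℝ) {ζ : ℂ} (hζ : ζ ≠ zetaTheta η x θ) :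
    support η x (Complex.exp (θ * Complex.I)) ζ <
      support η x (Complex.exp (θ * Complex.I)) (zetaTheta η x θ) := by
  rw [support_eq hx θ ζ]
  have hpos : 0 < ‖ζ - zetaTheta η x θ‖ ^ 2 := by
    have := norm_pos_iff.2 (sub_ne_zero.2 hζ)
    positivity
  have h := (Complex.abs_re_le_norm
    (conj (Complex.exp (θ * Complex.I)) * (η * (ζ - zetaTheta η x θ) ^ 2)))
  rw [norm_mul, Complex.norm_conj, Complex.norm_exp_ofReal_mul_I, one_mul, norm_mul,
    norm_pow] at h
  have := (abs_le.1 h).1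
  nlinarith

/-- Each solution gives a maximizer with `|ζ| = 1`, where the term containing `x` vanishes. Both
therefore maximize the same function on the circle and coincide; the critical point equation then
recovers `x`. -/
theorem eq_of_lhs_eq_rhs {η : ℂ} {x₁ x₂ θ : ℝ} (h₁ : ‖η‖ < x₁) (h₂ : ‖η‖ < x₂)
    (e₁ : lhs η x₁ θ = rhs η x₁) (e₂ : lhs η x₂ θ = rhs η x₂) : x₁ = x₂ := by
  have hn : ∀ {x : ℝ}, ‖η‖ < x → lhs η x θ = rhs η x → ‖zetaTheta η x θ‖ = 1 := by
    intro x hx he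
    rw [norm_zetaTheta hx, he]
    exact div_self (mul_pos two_pos (sq_sub_sq_norm_pos hx)).ne'
  have n₁ := hn h₁ e₁
  have n₂ := hn h₂ e₂
  have hz : zetaTheta η x₁ θ = zetaTheta η x₂ θ := by
    by_contra hne
    have l₁ := support_lt h₂ θ hne
    have l₂ := support_lt h₁ θ (Ne.symm hne)
    simp only [support, n₁, n₂] at l₁ l₂
    linarith
  have m₁ := mul_zetaTheta h₁ θ
  have m₂ := mul_zetaTheta h₂ θ
  rw [← hz, ← m₁] at m₂
  have hz0 : zetaTheta η x₁ θ ≠ 0 := by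
    intro h
    simp [h] at n₁
  exact_mod_cast (mul_right_cancel₀ hz0 m₂).symm

theorem exists_lhs_eq_rhs {η : ℂ} {t θ : ℝ} (ht : ‖η‖ < t) (h : rhs η t ≤ lhs η t θ) :
    ∃ x, t ≤ x ∧ lhs η x θ = rhs η x := by
  -- Here `M - |η| > 1`, so `2 (M - |η|) (M + |η|)` exceeds the bound `M + |η|` for the left side.
  set M := t + 1
  have hc : ContinuousOn (fun x => lhs η x θ - rhs η x) (Icc t M) := by
    unfold lhs rhs
    fun_prop
  have hM : lhs η M θ - rhs η M ≤ 0 := by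
    have h1 : lhs η M θ ≤ M + ‖η‖ := by
      refine (norm_sub_le _ _).trans ?_
      have : 0 ≤ M := by have := norm_nonneg η; simp only [M]; linarith
      rw [norm_mul, Complex.norm_real, Real.norm_of_nonneg this, Complex.norm_exp_ofReal_mul_I,
        Complex.norm_conj, mul_one]
    have h2 : rhs η M = 2 * (M - ‖η‖) * (M + ‖η‖) := by simp only [rhs]; ring
    have h3 : 1 < M - ‖η‖ := by simp only [M]; linarith
    have := norm_nonneg η
    rw [h2]
    nlinarith
  obtain ⟨x, hx, hx0⟩ := intermediate_value_Icc' (by simp [M] : t ≤ M) hc ⟨hM, sub_nonneg.2 h⟩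
  exact ⟨x, hx.1, sub_eq_zero.1 hx0⟩

theorem existsUnique_isTTheta {η : ℂ} {t : ℝ} (ht : ‖η‖ < t) (θ : ℝ) :
    ∃! x : ℝ, IsTTheta η t θ x := by
  by_cases h : rhs η t ≤ lhs η t θ
  · obtain ⟨x, hx, he⟩ := exists_lhs_eq_rhs ht h
    refine ⟨x, ⟨fun _ => ⟨ht.trans_le hx, he⟩, fun h' => absurd h h'⟩, fun y hy => ?_⟩
    exact eq_of_lhs_eq_rhs (hy.1 h).1 (ht.trans_le hx) (hy.1 h).2 he
  · exact ⟨t, ⟨fun h' => absurd h' h, fun _ => rfl⟩, fun y hy => hy.2 h⟩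

/-- The three properties of `t_θ` that matter for the maximization. -/
theorem IsTTheta.spec {η : ℂ} {t θ x : ℝ} (ht : ‖η‖ < t) (h : IsTTheta η t θ x) :
    t ≤ x ∧ ‖zetaTheta η x θ‖ ≤ 1 ∧ (x = t ∨ ‖zetaTheta η x θ‖ = 1) := by
  by_cases hle : rhs η t ≤ lhs η t θ
  · obtain ⟨hx, he⟩ := h.1 hle
    obtain ⟨y, hy, hey⟩ := exists_lhs_eq_rhs ht hle
    have hxy : x = y := eq_of_lhs_eq_rhs hx (ht.trans_le hy) he hey
    have : ‖zetaTheta η x θ‖ = 1 := by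
      rw [norm_zetaTheta hx, he]
      exact div_self (mul_pos two_pos (sq_sub_sq_norm_pos hx)).ne'
    exact ⟨hxy ▸ hy, this.le, Or.inr this⟩
  · have hx := h.2 hle
    subst hx
    refine ⟨le_rfl, ?_, Or.inl rfl⟩
    rw [norm_zetaTheta ht]
    exact (div_le_one (mul_pos two_pos (sq_sub_sq_norm_pos ht))).2 (not_le.1 hle).le

theorem IsTTheta.norm_zetaTheta_eq_one {η : ℂ} {t θ x : ℝ} (h : IsTTheta η t θ x)
    (hle : rhs η t ≤ lhs η t θ) : ‖zetaTheta η x θ‖ = 1 := by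
  obtain ⟨hx, he⟩ := h.1 hle
  rw [norm_zetaTheta hx, he]
  exact div_self (mul_pos two_pos (sq_sub_sq_norm_pos hx)).ne'

/-- If `|ζ_θ| = 1`, replacing `x` by `t ≤ x` subtracts `(x - t) (1 - |ζ|²)`, which is nonnegative on
the disk and zero at `ζ_θ`; the strict maximum survives. -/
theorem IsTTheta.support_lt {η : ℂ} {t θ x : ℝ} (ht : ‖η‖ < t) (h : IsTTheta η t θ x) {ζ : ℂ}
    (hζ : ‖ζ‖ ≤ 1) (hne : ζ ≠ zetaTheta η x θ) :
    support η t (Complex.exp (θ * Complex.I)) ζ <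
      support η t (Complex.exp (θ * Complex.I)) (zetaTheta η x θ) := by
  obtain ⟨hx, -, hor⟩ := h.spec ht
  rcases hor with rfl | h1
  · exact FourthDerivative.support_lt ht θ hne
  · have hlt := FourthDerivative.support_lt (ht.trans_le hx) θ hne
    simp only [support, h1] at hlt ⊢
    have h2 : 0 ≤ 1 - ‖ζ‖ ^ 2 := by nlinarith [norm_nonneg ζ]
    nlinarith [mul_nonneg (sub_nonneg.2 hx) h2]

theorem re_conj_mul_lt_one {u w : ℂ} (hu : ‖u‖ = 1) (hw : ‖w‖ ≤ 1) (hne : w ≠ u) :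
    (conj u * w).re < 1 := by
  have h : 0 < ‖w - u‖ ^ 2 := by
    have := norm_pos_iff.2 (sub_ne_zero.2 hne)
    positivity
  have e1 : ‖w - u‖ ^ 2 = ‖w‖ ^ 2 + ‖u‖ ^ 2 - 2 * (conj u * w).re := by
    simp only [← Complex.normSq_eq_norm_sq, Complex.normSq_apply]
    simp
    ring
  rw [hu] at e1
  nlinarith [norm_nonneg w]

/-- The boundary point of `discUnion 1 η t` in the direction `e^{iθ}`. -/
noncomputable def exposedPoint (η : ℂ) (t : ℝ) (ζ : ℂ) (θ : ℝ) : ℂ :=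
  c η ζ + ρ t ζ * Complex.exp (θ * Complex.I)

theorem exposedPoint_mem {η : ℂ} {t : ℝ} {ζ : ℂ} (hζ : ‖ζ‖ ≤ 1) (θ : ℝ) :
    exposedPoint η t ζ θ ∈ discUnion 1 η t := by
  refine ⟨ζ, _, hζ, (Complex.norm_exp_ofReal_mul_I θ).le, ?_⟩
  simp only [exposedPoint, c, ρ]
  push_cast
  ring

theorem re_conj_mul_exposedPoint (η : ℂ) (t : ℝ) (ζ : ℂ) (θ : ℝ) :
    (conj (Complex.exp (θ * Complex.I)) * exposedPoint η t ζ θ).re =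
      support η t (Complex.exp (θ * Complex.I)) ζ := by
  have hu := conj_mul_self_of_norm_eq_one (Complex.norm_exp_ofReal_mul_I θ)
  rw [exposedPoint, mul_add, mul_left_comm, hu, mul_one, Complex.add_re, Complex.ofReal_re]
  rfl

theorem re_conj_mul_lt_of_ne_exposedPoint {η : ℂ} {t θ x : ℝ} (ht : ‖η‖ < t)
    (h : IsTTheta η t θ x) {k : ℂ} (hk : k ∈ discUnion 1 η t)
    (hne : k ≠ exposedPoint η t (zetaTheta η x θ) θ) :
    (conj (Complex.exp (θ * Complex.I)) * k).re <
      (conj (Complex.exp (θ * Complex.I)) * exposedPoint η t (zetaTheta η x θ) θ).re := by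
  obtain ⟨ζ, w, hζ, hw, rfl⟩ := hk
  have ht0 : 0 < t := (norm_nonneg η).trans_lt ht
  rw [re_conj_mul_exposedPoint]
  have hu := Complex.norm_exp_ofReal_mul_I θ
  set u := Complex.exp (θ * Complex.I) with hu_def
  have hρ : 0 ≤ t * (1 - ‖ζ‖ ^ 2) := mul_nonneg ht0.le (by nlinarith [norm_nonneg ζ])
  have hre : (conj u * (1 * ζ - η * ζ ^ 2 + t * (1 - ‖ζ‖ ^ 2) * w)).re =
      (conj u * c η ζ).re + t * (1 - ‖ζ‖ ^ 2) * (conj u * w).re := by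
    rw [← Complex.re_ofReal_mul, ← Complex.add_re, c]
    congr 1
    push_cast
    ring
  rw [hre]
  have hw1 : (conj u * w).re ≤ 1 := by
    rcases eq_or_ne w u with rfl | hwu
    · rw [conj_mul_self_of_norm_eq_one hu]; simp
    · exact (re_conj_mul_lt_one hu hw hwu).le
  -- A competitor loses through `ζ` or, when `ζ` is optimal, through `w ≠ u`. In the latter case the
  -- radius is nonzero, since otherwise the point would not depend on `w`.
  by_cases hz : ζ = zetaTheta η x θ
  · subst hz
    have hρ0 : t * (1 - ‖zetaTheta η x θ‖ ^ 2) ≠ 0 := by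
      intro h0
      apply hne
      have h0' : (t * (1 - ‖zetaTheta η x θ‖ ^ 2) : ℂ) = 0 := by exact_mod_cast h0
      simp only [exposedPoint, c, ρ, h0, h0']
      push_cast
      ring
    have hwu : w ≠ u := by
      rintro rfl
      apply hne
      simp only [exposedPoint, c, ρ]
      push_cast
      ring
    have := re_conj_mul_lt_one hu hw hwu
    have := lt_of_le_of_ne hρ hρ0.symm
    simp only [support]
    nlinarith
  · have := h.support_lt ht hζ hz
    refine lt_of_le_of_lt ?_ this
    simp only [support]
    nlinarith

/-- Strict maximality forces equal `ζ`. A positive radius then gives the direction directly; on `|ζ|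
= 1`, norms in the critical point equation give `x = x'`, and the equation determines `e^{iθ}`. -/
theorem exp_eq_of_exposedPoint_eq {η : ℂ} {t θ θ' x x' : ℝ} (ht : ‖η‖ < t)
    (h : IsTTheta η t θ x) (h' : IsTTheta η t θ' x')
    (heq : exposedPoint η t (zetaTheta η x θ) θ = exposedPoint η t (zetaTheta η x' θ') θ') :
    Complex.exp (θ * Complex.I) = Complex.exp (θ' * Complex.I) := by
  have ht0 : 0 < t := (norm_nonneg η).trans_lt ht
  obtain ⟨hx, hn, -⟩ := h.spec ht
  obtain ⟨hx', hn', -⟩ := h'.spec ht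
  have hz : zetaTheta η x θ = zetaTheta η x' θ' := by
    by_contra hne
    have h1 := h'.support_lt ht hn hne
    rw [← re_conj_mul_exposedPoint η t (zetaTheta η x' θ'), ← heq] at h1
    have hu := Complex.norm_exp_ofReal_mul_I θ'
    set u := Complex.exp (θ' * Complex.I)
    have h2 : (conj u * exposedPoint η t (zetaTheta η x θ) θ).re ≤
        support η t u (zetaTheta η x θ) := by
      rw [exposedPoint, mul_add, Complex.add_re, mul_left_comm, Complex.re_ofReal_mul, support, ρ]
      have hρ : 0 ≤ t * (1 - ‖zetaTheta η x θ‖ ^ 2) :=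
        mul_nonneg ht0.le (by nlinarith [norm_nonneg (zetaTheta η x θ)])
      have h3 : (conj u * Complex.exp (θ * Complex.I)).re ≤ 1 := by
        refine (Complex.re_le_norm _).trans ?_
        rw [norm_mul, Complex.norm_conj, hu, Complex.norm_exp_ofReal_mul_I, one_mul]
      nlinarith
    exact absurd h1 (not_lt.2 h2)
  rw [exposedPoint, exposedPoint, ← hz, add_right_inj] at heq
  by_cases hρ : (ρ t (zetaTheta η x θ) : ℂ) = 0
  · have h1 : ‖zetaTheta η x θ‖ = 1 := by
      have : t * (1 - ‖zetaTheta η x θ‖ ^ 2) = 0 := by exact_mod_cast hρ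
      have := (mul_eq_zero.1 this).resolve_left ht0.ne'
      nlinarith [norm_nonneg (zetaTheta η x θ)]
    have e := mul_zetaTheta (ht.trans_le hx) θ
    have e' := mul_zetaTheta (ht.trans_le hx') θ'
    rw [← hz] at e'
    have hxn := congrArg norm e
    have hxn' := congrArg norm e'
    simp only [norm_mul, h1, Complex.norm_exp_ofReal_mul_I, mul_one, one_mul, Complex.norm_real,
      Real.norm_of_nonneg (ht0.le.trans hx), Real.norm_of_nonneg (ht0.le.trans hx')] at hxn hxn'
    have hxx : x = x' := hxn.trans hxn'.symm
    rw [← hxx, e] at e'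
    refine mul_right_cancel₀ ?_ e'
    rw [← norm_pos_iff, ← hxn]
    linarith
  · exact mul_left_cancel₀ hρ heq

theorem isParametrization_exposedPoint {η : ℂ} {t : ℝ} (ht : ‖η‖ < t) {T : ℝ → ℝ}
    (hT : ∀ θ, IsTTheta η t θ (T θ)) :
    IsParametrization (fun θ => exposedPoint η t (zetaTheta η (T θ) θ) θ)
      (frontier (discUnion 1 η t)) :=
  isParametrization_of_exposed (isCompact_discUnion _ _ _) (convex_discUnion ht)
    (interior_discUnion_nonempty _ _ ((norm_nonneg η).trans_lt ht))
    (fun θ => exposedPoint_mem ((hT θ).spec ht).2.1 θ)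
    (fun θ _ hk hne => re_conj_mul_lt_of_ne_exposedPoint ht (hT θ) hk hne)
    (fun θ θ' h => exp_eq_of_exposedPoint_eq ht (hT θ) (hT θ') h)

/-! ### The Schur step -/

/-- The Möbius map of the disk that sends `b` to `0`. -/
noncomputable def moebius (b w : ℂ) : ℂ := (w - b) / (1 - conj b * w)

theorem one_sub_conj_mul_ne_zero {b w : ℂ} (hb : ‖b‖ < 1) (hw : ‖w‖ ≤ 1) :
    1 - conj b * w ≠ 0 := by
  intro h
  have h1 : ‖conj b * w‖ = 1 := by rw [← sub_eq_zero.1 h]; simp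
  rw [norm_mul, Complex.norm_conj] at h1
  nlinarith [norm_nonneg w, norm_nonneg b]

theorem norm_moebius_lt_one {b w : ℂ} (hb : ‖b‖ < 1) (hw : ‖w‖ < 1) : ‖moebius b w‖ < 1 := by
  have h0 := one_sub_conj_mul_ne_zero hb hw.le
  rw [moebius, norm_div, div_lt_one (norm_pos_iff.2 h0)]
  have h1 : ‖1 - conj b * w‖ ^ 2 - ‖w - b‖ ^ 2 = (1 - ‖b‖ ^ 2) * (1 - ‖w‖ ^ 2) := by
    simp only [← Complex.normSq_eq_norm_sq, Complex.normSq_apply]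
    simp
    ring
  have h2 : 0 < (1 - ‖b‖ ^ 2) * (1 - ‖w‖ ^ 2) :=
    mul_pos (by nlinarith [norm_nonneg b]) (by nlinarith [norm_nonneg w])
  exact lt_of_pow_lt_pow_left₀ 2 (norm_nonneg _) (by linarith)

theorem moebius_neg_moebius {b w : ℂ} (hb : ‖b‖ < 1) (hw : ‖w‖ < 1) :
    moebius (-b) (moebius b w) = w := by
  have h0 := one_sub_conj_mul_ne_zero hb hw.le
  have h1 := one_sub_conj_mul_ne_zero hb hb.le
  have h2 := one_sub_conj_mul_ne_zero (b := -b) (by rwa [norm_neg])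
    (norm_moebius_lt_one hb hw).le
  have h3 : (1 - conj b * w) * (1 - conj (-b) * moebius b w) = 1 - conj b * b := by
    rw [moebius, map_neg]
    field_simp
    ring
  rw [moebius, div_eq_iff h2]
  apply mul_left_cancel₀ h0
  rw [mul_left_comm, h3, moebius]
  field_simp
  ring

theorem differentiableOn_moebius {b : ℂ} (hb : ‖b‖ < 1) {f : ℂ → ℂ} {s : Set ℂ}
    (hf : DifferentiableOn ℂ f s) (hm : MapsTo f s (ball 0 1)) :
    DifferentiableOn ℂ (fun z => moebius b (f z)) s := by
  refine DifferentiableOn.div (hf.sub_const b) ((hf.const_mul _).const_sub 1) fun z hz => ?_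
  exact one_sub_conj_mul_ne_zero hb (mem_ball_zero_iff.1 (hm hz)).le

theorem mapsTo_moebius {b : ℂ} (hb : ‖b‖ < 1) : MapsTo (moebius b) (ball 0 1) (ball 0 1) :=
  fun _ hw => mem_ball_zero_iff.2 (norm_moebius_lt_one hb (mem_ball_zero_iff.1 hw))

/-- `G` is obtained from `H` by a step of the Schur algorithm at the point `p` with parameter `b`,
that is `(G - b) / (1 - conj b G) = (z - p) / (1 - p z) H`. -/
def SchurRel (p : ℝ) (b : ℂ) (G H : ℂ → ℂ) : Prop :=
  ∀ z ∈ ball (0 : ℂ) 1,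
    G z * ((1 - p * z) + conj b * ((z - p) * H z)) = (z - p) * H z + b * (1 - p * z)

theorem exists_schurRel_of_parameter {p : ℝ} (hp : |p| < 1) {b : ℂ} (hb : ‖b‖ < 1) {H : ℂ → ℂ}
    (hd : DifferentiableOn ℂ H (ball 0 1)) (hm : MapsTo H (ball 0 1) (closedBall 0 1)) :
    ∃ G : ℂ → ℂ, DifferentiableOn ℂ G (ball 0 1) ∧ MapsTo G (ball 0 1) (ball 0 1) ∧
      SchurRel p b G H := by
  have hp' : ‖(p : ℂ)‖ < 1 := by rwa [Complex.norm_real]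
  have hb' : ‖-b‖ < 1 := by rwa [norm_neg]
  set X : ℂ → ℂ := fun z => moebius p z * H z with hX
  have hXd : DifferentiableOn ℂ X (ball 0 1) :=
    (differentiableOn_moebius hp' differentiableOn_id (mapsTo_id _)).mul hd
  have hXm : MapsTo X (ball 0 1) (ball 0 1) := by
    intro z hz
    have h1 := norm_moebius_lt_one hp' (mem_ball_zero_iff.1 hz)
    have h2 := mem_closedBall_zero_iff.1 (hm hz)
    rw [mem_ball_zero_iff, hX]
    simp only [norm_mul]
    nlinarith [norm_nonneg (H z), norm_nonneg (moebius p z)]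
  refine ⟨fun z => moebius (-b) (X z), differentiableOn_moebius hb' hXd hXm,
    (mapsTo_moebius hb').comp hXm, fun z hz => ?_⟩
  have h0 := one_sub_conj_mul_ne_zero hp' (mem_ball_zero_iff.1 hz).le
  have h1 := one_sub_conj_mul_ne_zero hb' (mem_ball_zero_iff.1 (hXm hz)).le
  rw [Complex.conj_ofReal] at h0
  have h2 : (1 - p * z) * X z = (z - p) * H z := by
    simp only [hX, moebius, Complex.conj_ofReal]
    field_simp
  have h3 : moebius (-b) (X z) * (1 - conj (-b) * X z) = X z - -b := div_mul_cancel₀ _ h1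
  rw [map_neg] at h3
  rw [← h2]
  linear_combination (1 - p * z) * h3

/-- Möbius maps move `p` and `G p` to `0`, and the Schwarz lemma bounds `dslope`, the quotient with
its singularity removed. The target is the closed ball because `H` may be a unimodular constant. -/
theorem exists_schurRel {p : ℝ} (hp : |p| < 1) {G : ℂ → ℂ}
    (hd : DifferentiableOn ℂ G (ball 0 1)) (hm : MapsTo G (ball 0 1) (ball 0 1)) :
    ∃ H : ℂ → ℂ, DifferentiableOn ℂ H (ball 0 1) ∧ MapsTo H (ball 0 1) (closedBall 0 1) ∧
      SchurRel p (G p) G H := by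
  have hp' : ‖(p : ℂ)‖ < 1 := by rwa [Complex.norm_real]
  have hp'' : ‖(-p : ℂ)‖ < 1 := by rwa [norm_neg]
  have hb : ‖G p‖ < 1 := mem_ball_zero_iff.1 (hm (mem_ball_zero_iff.2 hp'))
  have hψd := differentiableOn_moebius hp'' differentiableOn_id (mapsTo_id (ball (0 : ℂ) 1))
  set k : ℂ → ℂ := fun u => moebius (G p) (G (moebius (-p) u)) with hk
  have hkm : MapsTo k (ball 0 1) (ball 0 1) :=
    (mapsTo_moebius hb).comp (hm.comp (mapsTo_moebius hp''))
  have hkd : DifferentiableOn ℂ k (ball 0 1) :=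
    differentiableOn_moebius hb (hd.comp hψd (mapsTo_moebius hp''))
      (hm.comp (mapsTo_moebius hp''))
  have hk0 : k 0 = 0 := by simp [hk, moebius]
  have hh : DifferentiableOn ℂ (dslope k 0) (ball 0 1) :=
    (Complex.differentiableOn_dslope (ball_mem_nhds 0 one_pos)).2 hkd
  refine ⟨fun z => dslope k 0 (moebius p z),
    hh.comp (differentiableOn_moebius hp' differentiableOn_id (mapsTo_id _)) (mapsTo_moebius hp'),
    fun z hz => ?_, fun z hz => ?_⟩
  · rw [mem_closedBall_zero_iff]
    have := Complex.norm_dslope_le_div_of_mapsTo_ball (R₂ := 1) hkd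
      (by rw [hk0]; exact hkm.mono_right ball_subset_closedBall) (mapsTo_moebius hp' hz)
    simpa using this
  · have h0 := one_sub_conj_mul_ne_zero hp' (mem_ball_zero_iff.1 hz).le
    have h1 := one_sub_conj_mul_ne_zero hb (mem_ball_zero_iff.1 (hm hz)).le
    have h2 := sub_smul_dslope k 0 (moebius p z)
    rw [hk0, sub_zero, sub_zero, smul_eq_mul] at h2
    simp only [hk] at h2
    rw [moebius_neg_moebius hp' (mem_ball_zero_iff.1 hz)] at h2
    simp only [hk]
    set d := dslope (fun u => moebius (G p) (G (moebius (-p) u))) 0 (moebius p z)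
    rw [moebius, moebius, div_mul_eq_mul_div, div_eq_div_iff h0 h1, Complex.conj_ofReal] at h2
    linear_combination -h2

/-- The maximum principle; it restores the open ball needed for the next Schur step. -/
theorem mapsTo_ball_of_norm_lt {p : ℂ} (hp : p ∈ ball (0 : ℂ) 1) {G : ℂ → ℂ}
    (hd : DifferentiableOn ℂ G (ball 0 1)) (hm : MapsTo G (ball 0 1) (closedBall 0 1))
    (hG : ‖G p‖ < 1) : MapsTo G (ball 0 1) (ball 0 1) := by
  intro z hz
  rw [mem_ball_zero_iff]
  refine lt_of_le_of_ne (mem_closedBall_zero_iff.1 (hm hz)) fun h1 => ?_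
  have hmax : IsMaxOn (norm ∘ G) (ball 0 1) z := fun y hy => by
    simpa [h1] using mem_closedBall_zero_iff.1 (hm hy)
  have := Complex.norm_eqOn_of_isPreconnected_of_isMaxOn (convex_ball (0 : ℂ) 1).isPreconnected
    isOpen_ball hd hz hmax hp
  simp only [Function.comp, Function.const] at this
  linarith

theorem eqOn_const_of_norm_eq_one {p : ℂ} (hp : p ∈ ball (0 : ℂ) 1) {G : ℂ → ℂ}
    (hd : DifferentiableOn ℂ G (ball 0 1)) (hm : MapsTo G (ball 0 1) (closedBall 0 1))
    (hG : ‖G p‖ = 1) : EqOn G (fun _ => G p) (ball 0 1) := by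
  have hmax : IsMaxOn (norm ∘ G) (ball 0 1) p := fun y hy => by
    simpa [hG] using mem_closedBall_zero_iff.1 (hm hy)
  exact Complex.eqOn_of_isPreconnected_of_isMaxOn_norm (convex_ball (0 : ℂ) 1).isPreconnected
    isOpen_ball hd hp hmax

/-! ### Taylor coefficients -/

/-- The Taylor series of `f` at `p`. -/
noncomputable def taylor (p : ℂ) (f : ℂ → ℂ) : PowerSeries ℂ :=
  PowerSeries.mk fun k => iteratedDeriv k f p / (k.factorial : ℂ)

theorem taylor_congr {p : ℂ} {f g : ℂ → ℂ} (h : f =ᶠ[nhds p] g) : taylor p f = taylor p g := by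
  ext k
  simp only [taylor, PowerSeries.coeff_mk, h.iteratedDeriv_eq k]

theorem taylor_add {p : ℂ} {f g : ℂ → ℂ} (hf : AnalyticAt ℂ f p) (hg : AnalyticAt ℂ g p) :
    taylor p (fun z => f z + g z) = taylor p f + taylor p g := by
  ext k
  simp only [taylor, PowerSeries.coeff_mk, map_add]
  rw [iteratedDeriv_fun_add hf.contDiffAt hg.contDiffAt, add_div]

theorem taylor_mul {p : ℂ} {f g : ℂ → ℂ} (hf : AnalyticAt ℂ f p) (hg : AnalyticAt ℂ g p) :
    taylor p (fun z => f z * g z) = taylor p f * taylor p g := by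
  ext k
  simp only [taylor, PowerSeries.coeff_mk, PowerSeries.coeff_mul]
  rw [iteratedDeriv_fun_mul hf.contDiffAt hg.contDiffAt,
    Finset.Nat.sum_antidiagonal_eq_sum_range_succ_mk, Finset.sum_div]
  refine Finset.sum_congr rfl fun i hi => ?_
  have hi' : i ≤ k := Nat.lt_succ_iff.1 (Finset.mem_range.1 hi)
  have h := Nat.choose_mul_factorial_mul_factorial hi'
  have h1 : (i.factorial : ℂ) ≠ 0 := by exact_mod_cast i.factorial_ne_zero
  have h2 : ((k - i).factorial : ℂ) ≠ 0 := by exact_mod_cast (k - i).factorial_ne_zero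
  have h3 : (k.factorial : ℂ) ≠ 0 := by exact_mod_cast k.factorial_ne_zero
  have h4 : (k.choose i : ℂ) * i.factorial * (k - i).factorial = k.factorial := by exact_mod_cast h
  rw [div_mul_div_comm, div_eq_div_iff h3 (mul_ne_zero h1 h2), ← h4]
  ring

theorem taylor_const (p a : ℂ) : taylor p (fun _ => a) = PowerSeries.C a := by
  ext k
  simp only [taylor, PowerSeries.coeff_mk, PowerSeries.coeff_C, iteratedDeriv_const]
  rcases k with _ | k <;> simp

theorem taylor_id (p : ℂ) : taylor p (fun z => z) = PowerSeries.C p + PowerSeries.X := by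
  ext k
  simp only [taylor, PowerSeries.coeff_mk, map_add, PowerSeries.coeff_C, PowerSeries.coeff_X]
  rcases k with _ | _ | k
  · simp
  · simp
  · rw [iteratedDeriv_succ', iteratedDeriv_succ']
    simp

/-- The `k`-th Taylor coefficient of `f` at `p`. -/
noncomputable def taylorCoeff (p : ℂ) (f : ℂ → ℂ) (k : ℕ) : ℂ :=
  iteratedDeriv k f p / (k.factorial : ℂ)

theorem coeff_taylor (p : ℂ) (f : ℂ → ℂ) (k : ℕ) :
    PowerSeries.coeff k (taylor p f) = taylorCoeff p f k := by
  simp [taylor, taylorCoeff]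

theorem taylorCoeff_zero (p : ℂ) (f : ℂ → ℂ) : taylorCoeff p f 0 = f p := by
  simp [taylorCoeff]

theorem taylorCoeff_one (p : ℂ) (f : ℂ → ℂ) : taylorCoeff p f 1 = deriv f p := by
  simp [taylorCoeff]

theorem SchurRel.taylor_eq {p : ℝ} {b z₀ : ℂ} {G H : ℂ → ℂ} (h : SchurRel p b G H)
    (hz₀ : z₀ ∈ ball (0 : ℂ) 1) (hG : AnalyticAt ℂ G z₀) (hH : AnalyticAt ℂ H z₀) :
    taylor z₀ G * (PowerSeries.C 1 + PowerSeries.C (-p : ℂ) * (PowerSeries.C z₀ + PowerSeries.X) +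
        PowerSeries.C (conj b) * ((PowerSeries.C z₀ + PowerSeries.X + PowerSeries.C (-p : ℂ)) *
          taylor z₀ H)) =
      (PowerSeries.C z₀ + PowerSeries.X + PowerSeries.C (-p : ℂ)) * taylor z₀ H +
        PowerSeries.C b * (PowerSeries.C 1 +
          PowerSeries.C (-p : ℂ) * (PowerSeries.C z₀ + PowerSeries.X)) := by
  -- Differences are written as sums so that the rules for sums, products, constants and the
  -- identity suffice.
  have hev : (fun z => G z * ((1 + -p * z) + conj b * ((z + -p) * H z))) =ᶠ[nhds z₀]
      fun z => (z + -p) * H z + b * (1 + -p * z) := by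
    filter_upwards [isOpen_ball.mem_nhds hz₀] with z hz
    have := h z hz
    simpa only [sub_eq_add_neg, neg_mul] using this
  have hc : ∀ a : ℂ, AnalyticAt ℂ (fun _ : ℂ => a) z₀ := fun a => analyticAt_const
  have hi : AnalyticAt ℂ (fun z : ℂ => z) z₀ := analyticAt_id
  have hu : AnalyticAt ℂ (fun z : ℂ => z + -p) z₀ := hi.fun_add (hc _)
  have hl : AnalyticAt ℂ (fun z : ℂ => 1 + -p * z) z₀ := (hc 1).fun_add ((hc _).fun_mul hi)
  have hT := taylor_congr hev
  rw [taylor_mul hG (hl.fun_add ((hc _).fun_mul (hu.fun_mul hH))),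
    taylor_add hl ((hc _).fun_mul (hu.fun_mul hH)), taylor_add (hc 1) ((hc _).fun_mul hi),
    taylor_mul (hc _) hi, taylor_mul (hc _) (hu.fun_mul hH), taylor_mul hu hH,
    taylor_add hi (hc _), taylor_add (hu.fun_mul hH) ((hc _).fun_mul hl),
    taylor_mul hu hH, taylor_mul (hc _) hl, taylor_add (hc 1) ((hc _).fun_mul hi),
    taylor_mul (hc _) hi, taylor_add hi (hc _)] at hT
  simpa only [taylor_const, taylor_id] using hT

/-- In the variable `X = z - r` one has `1 - r z = (1 - r²) - r X`, so comparing coefficients of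
`X^(k+1)` yields a recursion for those of `G`. -/
theorem SchurRel.taylorCoeff_eq {r : ℝ} {b : ℂ} {G H : ℂ → ℂ} (h : SchurRel r b G H)
    (hr : (r : ℂ) ∈ ball (0 : ℂ) 1) (hG : AnalyticAt ℂ G r) (hH : AnalyticAt ℂ H r) :
    G r = b ∧
    (1 - r ^ 2) * taylorCoeff r G 1 = (1 - conj b * b) * taylorCoeff r H 0 ∧
    (1 - r ^ 2) * taylorCoeff r G 2 = (1 - conj b * b) * taylorCoeff r H 1 +
      taylorCoeff r G 1 * (r - conj b * taylorCoeff r H 0) ∧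
    (1 - r ^ 2) * taylorCoeff r G 3 = (1 - conj b * b) * taylorCoeff r H 2 +
      taylorCoeff r G 2 * (r - conj b * taylorCoeff r H 0) -
      conj b * taylorCoeff r G 1 * taylorCoeff r H 1 ∧
    (1 - r ^ 2) * taylorCoeff r G 4 = (1 - conj b * b) * taylorCoeff r H 3 +
      taylorCoeff r G 3 * (r - conj b * taylorCoeff r H 0) -
      conj b * (taylorCoeff r G 2 * taylorCoeff r H 1 + taylorCoeff r G 1 * taylorCoeff r H 2) := by
  have hrn : r ^ 2 < 1 := by
    rw [mem_ball_zero_iff, Complex.norm_real, Real.norm_eq_abs] at hr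
    exact (sq_lt_one_iff_abs_lt_one r).2 hr
  have he : (1 - r ^ 2 : ℂ) ≠ 0 := by
    have : (1 - r ^ 2 : ℝ) ≠ 0 := by linarith
    exact_mod_cast this
  have h0 : G r = b := by
    have := h r hr
    apply mul_right_cancel₀ he
    linear_combination this
  have hT := h.taylor_eq hr hG hH
  have hU : (PowerSeries.C (r : ℂ) + PowerSeries.X + PowerSeries.C (-r : ℂ)) = PowerSeries.X := by
    rw [map_neg]; ring
  have hL : PowerSeries.C 1 + PowerSeries.C (-r : ℂ) * (PowerSeries.C (r : ℂ) + PowerSeries.X) =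
      PowerSeries.C (1 - (r : ℂ) ^ 2) - PowerSeries.C (r : ℂ) * PowerSeries.X := by
    simp only [map_sub, map_neg, map_pow]; ring
  rw [hU, hL] at hT
  have hT' : PowerSeries.C (1 - (r : ℂ) ^ 2) * taylor r G =
      PowerSeries.C (b * (1 - (r : ℂ) ^ 2)) + PowerSeries.X * (taylor r H - PowerSeries.C (r * b) +
        PowerSeries.C (r : ℂ) * taylor r G -
        PowerSeries.C (conj b) * (taylor r G * taylor r H)) := by
    simp only [map_mul] at hT ⊢
    linear_combination hT
  have hk : ∀ k, (1 - (r : ℂ) ^ 2) * taylorCoeff r G (k + 1) =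
      taylorCoeff r H k - PowerSeries.coeff k (PowerSeries.C (r * b)) + r * taylorCoeff r G k -
        conj b * PowerSeries.coeff k (taylor r G * taylor r H) := by
    intro k
    have := congrArg (PowerSeries.coeff (k + 1)) hT'
    rw [map_add, PowerSeries.coeff_succ_X_mul] at this
    rw [PowerSeries.coeff_C_mul, PowerSeries.coeff_C, if_neg k.succ_ne_zero, zero_add] at this
    simpa only [PowerSeries.coeff_C_mul, map_add, map_sub, coeff_taylor] using this
  have hp : ∀ k, PowerSeries.coeff k (taylor r G * taylor r H) =
      ∑ i ∈ Finset.range (k + 1), taylorCoeff r G i * taylorCoeff r H (k - i) := by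
    intro k
    rw [PowerSeries.coeff_mul, Finset.Nat.sum_antidiagonal_eq_sum_range_succ_mk]
    simp only [coeff_taylor]
  have k0 := hk 0
  have k1 := hk 1
  have k2 := hk 2
  have k3 := hk 3
  simp only [hp, Finset.sum_range_succ, Finset.sum_range_zero, zero_add, PowerSeries.coeff_C,
    Nat.sub_self, Nat.sub_zero, if_true, one_ne_zero, if_false, taylorCoeff_zero, h0,
    OfNat.ofNat_ne_zero] at k0 k1 k2 k3
  norm_num at k0 k1 k2 k3
  simp only [taylorCoeff_zero]
  refine ⟨h0, ?_, ?_, ?_, ?_⟩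
  · linear_combination k0
  · linear_combination k1
  · linear_combination k2
  · linear_combination k3

theorem SchurRel.taylorCoeff_succ_of_zero {z₀ : ℂ} {f g : ℂ → ℂ} (h : SchurRel 0 0 f g)
    (hz₀ : z₀ ∈ ball (0 : ℂ) 1) (hf : AnalyticAt ℂ f z₀) (hg : AnalyticAt ℂ g z₀) (k : ℕ) :
    taylorCoeff z₀ f (k + 1) = z₀ * taylorCoeff z₀ g (k + 1) + taylorCoeff z₀ g k := by
  have hT := h.taylor_eq hz₀ hf hg
  simp only [Complex.ofReal_zero, neg_zero, map_zero, map_one, zero_mul, add_zero, mul_one,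
    add_mul] at hT
  have := congrArg (PowerSeries.coeff (k + 1)) hT
  simpa only [map_add, PowerSeries.coeff_C_mul, PowerSeries.coeff_succ_X_mul, coeff_taylor]
    using this

theorem SchurRel.eq_mul {f g : ℂ → ℂ} (h : SchurRel 0 0 f g) {z : ℂ} (hz : z ∈ ball (0 : ℂ) 1) :
    f z = z * g z := by
  simpa using h z hz

/-! ### Derivatives along the Schur algorithm -/

theorem mul_conj_ofReal_div (r s : ℝ) : conj ((s : ℂ) / r) * (s / r) = (s / r) ^ 2 := by
  simp [pow_two]

section

variable {r s : ℝ} {lam mu : ℂ} {f g g₁ g₂ g₃ : ℂ → ℂ}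

theorem one_sub_sq_ne_zero (hr0 : 0 < r) (hr : r < 1) : (1 - (r : ℂ) ^ 2) ≠ 0 := by
  have : (1 - r ^ 2 : ℝ) ≠ 0 := by nlinarith
  exact_mod_cast this

theorem deriv_of_schurRel (hr0 : 0 < r) (hr : r < 1)
    (hf : AnalyticAt ℂ f r) (hg : AnalyticAt ℂ g r) (hg₁ : AnalyticAt ℂ g₁ r)
    (h : SchurRel 0 0 f g) (h₀ : SchurRel r (s / r) g g₁) :
    f r = s ∧ deriv f r = c₁ r s + ρ₁ r s * g₁ r := by
  have hmem : (r : ℂ) ∈ ball (0 : ℂ) 1 := by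
    rwa [mem_ball_zero_iff, Complex.norm_real, Real.norm_of_nonneg hr0.le]
  have he := one_sub_sq_ne_zero hr0 hr
  have hr' : (r : ℂ) ≠ 0 := by exact_mod_cast hr0.ne'
  obtain ⟨g0, e1, -⟩ := h₀.taylorCoeff_eq hmem hg hg₁
  have f1 := h.taylorCoeff_succ_of_zero hmem hf hg 0
  rw [mul_conj_ofReal_div] at e1
  simp only [zero_add, taylorCoeff_zero, taylorCoeff_one] at f1 e1
  refine ⟨?_, ?_⟩
  · rw [h.eq_mul hmem, g0]
    field_simp
  · rw [f1, g0, c₁, ρ₁, eq_div_of_mul_eq he ((mul_comm _ _).trans e1)]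
    push_cast
    field_simp
    ring

theorem iteratedDeriv_two_of_schurRel (hr0 : 0 < r) (hr : r < 1)
    (hf : AnalyticAt ℂ f r) (hg : AnalyticAt ℂ g r) (hg₁ : AnalyticAt ℂ g₁ r)
    (hg₂ : AnalyticAt ℂ g₂ r) (h : SchurRel 0 0 f g) (h₀ : SchurRel r (s / r) g g₁)
    (h₁ : SchurRel r lam g₁ g₂) :
    iteratedDeriv 2 f r = c₂ r s lam + ρ₂ r s lam * g₂ r := by
  have hmem : (r : ℂ) ∈ ball (0 : ℂ) 1 := by
    rwa [mem_ball_zero_iff, Complex.norm_real, Real.norm_of_nonneg hr0.le]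
  have he := one_sub_sq_ne_zero hr0 hr
  have hr' : (r : ℂ) ≠ 0 := by exact_mod_cast hr0.ne'
  obtain ⟨g0, e1, e2, -⟩ := h₀.taylorCoeff_eq hmem hg hg₁
  obtain ⟨b0, d1, -⟩ := h₁.taylorCoeff_eq hmem hg₁ hg₂
  have f2 := h.taylorCoeff_succ_of_zero hmem hf hg 1
  have f2' : taylorCoeff r f 2 = iteratedDeriv 2 f r / 2 := by simp [taylorCoeff]
  rw [mul_conj_ofReal_div] at e1 e2
  have hconj : conj ((s : ℂ) / r) = s / r := by simp
  have hlam : conj lam * lam = (‖lam‖ : ℂ) ^ 2 := Complex.conj_mul' lam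
  rw [taylorCoeff_zero, b0] at e1 e2
  rw [taylorCoeff_zero, hlam] at d1
  rw [hconj] at e2
  rw [eq_div_of_mul_eq he ((mul_comm _ _).trans e1),
    eq_div_of_mul_eq he ((mul_comm _ _).trans d1)] at e2
  rw [f2', eq_div_of_mul_eq he ((mul_comm _ _).trans e1),
    eq_div_of_mul_eq he ((mul_comm _ _).trans e2)] at f2
  have f2'' : iteratedDeriv 2 f r = _ := (div_eq_iff two_ne_zero).1 f2
  rw [f2'', c₂, ρ₂]
  push_cast
  field_simp
  ring

theorem iteratedDeriv_four_of_schurRel (hr0 : 0 < r) (hr : r < 1)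
    (hf : AnalyticAt ℂ f r) (hg : AnalyticAt ℂ g r) (hg₁ : AnalyticAt ℂ g₁ r)
    (hg₂ : AnalyticAt ℂ g₂ r) (hg₃ : AnalyticAt ℂ g₃ r) (h : SchurRel 0 0 f g)
    (h₀ : SchurRel r (s / r) g g₁) (h₁ : SchurRel r lam g₁ g₂) (h₂ : SchurRel r mu g₂ g₃) :
    iteratedDeriv 4 f r = A r s * (B r s lam mu + r ^ 2 * (1 - ‖lam‖ ^ 2) * (1 - ‖mu‖ ^ 2) *
      (D r s lam mu * g₃ r - r * conj mu * g₃ r ^ 2 + r * ((1 - r ^ 2) * deriv g₃ r))) := by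
  have hmem : (r : ℂ) ∈ ball (0 : ℂ) 1 := by
    rwa [mem_ball_zero_iff, Complex.norm_real, Real.norm_of_nonneg hr0.le]
  have he := one_sub_sq_ne_zero hr0 hr
  have hr' : (r : ℂ) ≠ 0 := by exact_mod_cast hr0.ne'
  obtain ⟨g0, e1, e2, e3, e4⟩ := h₀.taylorCoeff_eq hmem hg hg₁
  obtain ⟨b0, d1, d2, d3, -⟩ := h₁.taylorCoeff_eq hmem hg₁ hg₂
  obtain ⟨m0, k1, k2, -⟩ := h₂.taylorCoeff_eq hmem hg₂ hg₃
  have f4 := h.taylorCoeff_succ_of_zero hmem hf hg 3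
  have f4' : taylorCoeff r f 4 = iteratedDeriv 4 f r / 24 := by
    simp [taylorCoeff, Nat.factorial]
  have hconj : conj ((s : ℂ) / r) = s / r := by simp
  have hs : (s : ℂ) = (s / r) * r := by field_simp
  rw [hconj] at e1 e2 e3 e4
  simp only [taylorCoeff_zero, b0, m0] at e1 e2 e3 e4 d1 d2 d3 k1 k2
  rw [taylorCoeff_one] at k2
  norm_num at f4
  rw [f4', div_eq_iff (by norm_num)] at f4
  rw [f4, A, B, D, ← Complex.conj_mul' lam, ← Complex.conj_mul' mu]
  push_cast
  clear f4 f4' h h₀ h₁ h₂ hf hg hg₁ hg₂ hg₃ hconj g0 b0 m0 hmem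
  -- What remains is a polynomial identity; conjugates become independent letters.
  generalize (s : ℂ) / r = a at *
  rw [hs]
  clear hs
  generalize (r : ℂ) = R at *
  generalize taylorCoeff R g 1 = x1 at *
  generalize taylorCoeff R g 2 = x2 at *
  generalize taylorCoeff R g 3 = x3 at *
  generalize taylorCoeff R g 4 = x4 at *
  generalize taylorCoeff R g₁ 1 = y1 at *
  generalize taylorCoeff R g₁ 2 = y2 at *
  generalize taylorCoeff R g₁ 3 = y3 at *
  generalize taylorCoeff R g₂ 1 = z1 at *
  generalize taylorCoeff R g₂ 2 = z2 at *
  generalize conj lam = lam' at *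
  generalize conj mu = mu' at *
  generalize g₃ R = ζ at *
  generalize deriv g₃ R = w at *
  rw [div_mul_eq_mul_div, eq_div_iff (mul_ne_zero (pow_ne_zero _ hr') (pow_ne_zero _ he))]
  obtain ⟨e, hE⟩ : ∃ e, e = 1 - R ^ 2 := ⟨_, rfl⟩
  rw [← hE] at e1 e2 e3 e4 d1 d2 d3 k1 k2 ⊢
  obtain ⟨L, hL⟩ : ∃ L, L = 1 - lam' * lam := ⟨_, rfl⟩
  obtain ⟨M, hM⟩ : ∃ M, M = 1 - mu' * mu := ⟨_, rfl⟩
  obtain ⟨P, hP⟩ : ∃ P, P = 1 - a ^ 2 := ⟨_, rfl⟩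
  obtain ⟨q, hq⟩ : ∃ q, q = R - a * lam := ⟨_, rfl⟩
  obtain ⟨p, hp⟩ : ∃ p, p = R - lam' * mu := ⟨_, rfl⟩
  simp only [← pow_two a, ← hL, ← hM, ← hP, ← hq, ← hp] at e1 e2 e3 e4 d1 d2 d3 k1 k2
  -- Multiplying the `k`-th coefficient by `e ^ k` clears denominators, and naming each result keeps
  -- the intermediate expressions small.
  obtain ⟨Z2, hZ2⟩ : ∃ Z, Z = M * (e * w) + M * ζ * (R - mu' * ζ) := ⟨_, rfl⟩
  have k2' : e ^ 2 * z2 = Z2 := by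
    rw [hZ2]; linear_combination e * k2 + (R - mu' * ζ) * k1
  obtain ⟨Y2, hY2⟩ : ∃ Y, Y = L * (M * ζ) + L * mu * p := ⟨_, rfl⟩
  have d2' : e ^ 2 * y2 = Y2 := by
    rw [hY2]; linear_combination e * d2 + p * d1 + L * k1
  obtain ⟨Y3, hY3⟩ : ∃ Y, Y = L * Z2 + Y2 * p - lam' * (L * mu) * (M * ζ) := ⟨_, rfl⟩
  have d3' : e ^ 3 * y3 = Y3 := by
    rw [hY3]
    linear_combination e ^ 2 * d3 + L * k2' + p * d2' - lam' * z1 * e * d1 - lam' * (L * mu) * k1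
  obtain ⟨X2, hX2⟩ : ∃ X, X = P * (L * mu) + P * lam * q := ⟨_, rfl⟩
  have e2' : e ^ 2 * x2 = X2 := by
    rw [hX2]; linear_combination e * e2 + P * d1 + q * e1
  obtain ⟨X3, hX3⟩ : ∃ X, X = P * Y2 + X2 * q - a * (P * lam) * (L * mu) := ⟨_, rfl⟩
  have e3' : e ^ 3 * x3 = X3 := by
    rw [hX3]
    linear_combination e ^ 2 * e3 + P * d2' + q * e2' - a * (y1 * e * e1 + P * lam * d1)
  obtain ⟨X4, hX4⟩ : ∃ X, X = P * Y3 + X3 * q - a * (X2 * (L * mu) + P * lam * Y2) := ⟨_, rfl⟩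
  have e4' : e ^ 4 * x4 = X4 := by
    rw [hX4]
    linear_combination e ^ 3 * e4 + P * d3' + q * e3' -
      a * (y1 * e * e2' + X2 * d1 + e ^ 2 * y2 * e1 + P * lam * d2')
  clear k1 k2 d1 d2 d3 e1 e2 e3 e4 k2' d2' d3' e2'
  have key : (R * x4 + x3) * 24 * (R ^ 4 * e ^ 4) = 24 * R ^ 4 * (R * X4 + e * X3) := by
    linear_combination 24 * R ^ 5 * e4' + 24 * R ^ 4 * e * e3'
  rw [key, hX4, hX3, hX2, hY3, hY2, hZ2, hP, hq, hp, hM, hL, hE]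
  ring

end

/-! ### The variability region -/

/-- Schwarz–Pick as one more Schur step, with `w = H r`; if `|G r| = 1`, then `G` is constant. -/
theorem exists_deriv_eq {r : ℝ} (hr : |r| < 1) {G : ℂ → ℂ} (hd : DifferentiableOn ℂ G (ball 0 1))
    (hm : MapsTo G (ball 0 1) (closedBall 0 1)) :
    ∃ w : ℂ, ‖w‖ ≤ 1 ∧ (1 - r ^ 2) * deriv G r = (1 - ‖G r‖ ^ 2) * w := by
  have hmem : (r : ℂ) ∈ ball (0 : ℂ) 1 := by
    rwa [mem_ball_zero_iff, Complex.norm_real]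
  have hnhds := isOpen_ball.mem_nhds hmem
  rcases (mem_closedBall_zero_iff.1 (hm hmem)).lt_or_eq with hlt | heq
  · obtain ⟨H, hHd, hHm, hrel⟩ := exists_schurRel hr hd (mapsTo_ball_of_norm_lt hmem hd hm hlt)
    obtain ⟨-, h1, -⟩ :=
      hrel.taylorCoeff_eq hmem (hd.analyticAt hnhds) (hHd.analyticAt hnhds)
    rw [taylorCoeff_one, taylorCoeff_zero, Complex.conj_mul'] at h1
    exact ⟨H r, mem_closedBall_zero_iff.1 (hHm hmem), h1⟩
  · refine ⟨0, by simp, ?_⟩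
    have hev : G =ᶠ[nhds (r : ℂ)] fun _ => G r := by
      filter_upwards [hnhds] with z hz using eqOn_const_of_norm_eq_one hmem hd hm heq hz
    rw [hev.deriv_eq]
    simp

/-- Sharpness of Schwarz–Pick: take a Schur step with constant parameter `w`, or a constant `G` if
`|ζ| = 1`. -/
theorem exists_of_deriv_eq {r : ℝ} (hr : |r| < 1) {ζ w : ℂ} (hζ : ‖ζ‖ ≤ 1) (hw : ‖w‖ ≤ 1) :
    ∃ G : ℂ → ℂ, DifferentiableOn ℂ G (ball 0 1) ∧ MapsTo G (ball 0 1) (closedBall 0 1) ∧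
      G r = ζ ∧ (1 - r ^ 2) * deriv G r = (1 - ‖ζ‖ ^ 2) * w := by
  have hmem : (r : ℂ) ∈ ball (0 : ℂ) 1 := by
    rwa [mem_ball_zero_iff, Complex.norm_real]
  have hnhds := isOpen_ball.mem_nhds hmem
  rcases hζ.lt_or_eq with hlt | heq
  · obtain ⟨G, hd, hm, hrel⟩ := exists_schurRel_of_parameter hr hlt (H := fun _ => w)
      (differentiableOn_const _) (fun _ _ => mem_closedBall_zero_iff.2 hw)
    obtain ⟨h0, h1, -⟩ :=
      hrel.taylorCoeff_eq hmem (hd.analyticAt hnhds) analyticAt_const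
    rw [taylorCoeff_one, taylorCoeff_zero, Complex.conj_mul'] at h1
    exact ⟨G, hd, hm.mono_right ball_subset_closedBall, h0, h1⟩
  · refine ⟨fun _ => ζ, differentiableOn_const _, fun _ _ => mem_closedBall_zero_iff.2 hζ, rfl, ?_⟩
    simp [heq]

theorem ρ₁_ne_zero {r s : ℝ} (hs : 0 ≤ s) (hsr : s < r) (hr : r < 1) : (ρ₁ r s : ℂ) ≠ 0 := by
  have hr0 : 0 < r := hs.trans_lt hsr
  have h1 : 0 < r ^ 2 - s ^ 2 := by nlinarith
  have h2 : 0 < 1 - r ^ 2 := by nlinarith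
  have : 0 < ρ₁ r s := by unfold ρ₁; positivity
  exact_mod_cast this.ne'

theorem ρ₂_ne_zero {r s : ℝ} {lam : ℂ} (hs : 0 ≤ s) (hsr : s < r) (hr : r < 1)
    (hlam : ‖lam‖ < 1) : (ρ₂ r s lam : ℂ) ≠ 0 := by
  have hr0 : 0 < r := hs.trans_lt hsr
  have h1 : 0 < r ^ 2 - s ^ 2 := by nlinarith
  have h2 : 0 < 1 - r ^ 2 := by nlinarith
  have h3 : 0 < 1 - ‖lam‖ ^ 2 := by nlinarith [norm_nonneg lam]
  have : 0 < ρ₂ r s lam := by unfold ρ₂; positivity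
  exact_mod_cast this.ne'

theorem A_ne_zero {r s : ℝ} (hs : 0 ≤ s) (hsr : s < r) (hr : r < 1) : (A r s : ℂ) ≠ 0 := by
  have hr0 : 0 < r := hs.trans_lt hsr
  have h1 : 0 < r ^ 2 - s ^ 2 := by nlinarith
  have h2 : 0 < 1 - r ^ 2 := by nlinarith
  have : 0 < A r s := by unfold A; positivity
  exact_mod_cast this.ne'

/-- The positive factor `r² (1 - |lam|²) (1 - |mu|²)` of `C`. -/
noncomputable def scale (r : ℝ) (lam mu : ℂ) : ℂ := r ^ 2 * (1 - ‖lam‖ ^ 2) * (1 - ‖mu‖ ^ 2)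

theorem scale_ne_zero {r : ℝ} {lam mu : ℂ} (hr0 : 0 < r) (hlam : ‖lam‖ < 1) (hmu : ‖mu‖ < 1) :
    scale r lam mu ≠ 0 := by
  have h1 : 0 < 1 - ‖lam‖ ^ 2 := by nlinarith [norm_nonneg lam]
  have h2 : 0 < 1 - ‖mu‖ ^ 2 := by nlinarith [norm_nonneg mu]
  have : r ^ 2 * (1 - ‖lam‖ ^ 2) * (1 - ‖mu‖ ^ 2) ≠ 0 := by positivity
  unfold scale
  exact_mod_cast this

/-- The Schur algorithm run down from `f` gives one inclusion, and run up from `g₃` the other. The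
nonzero radii `ρ₁`, `ρ₂` let the prescribed derivatives identify `g₁ r` and `g₂ r`. -/
theorem V_eq_image {r s : ℝ} {lam mu : ℂ} (hs : 0 ≤ s) (hsr : s < r) (hr : r < 1)
    (hlam : ‖lam‖ < 1) (hmu : ‖mu‖ < 1) :
    V r s lam mu = (fun k => A r s * scale r lam mu * k + A r s * B r s lam mu) ''
      discUnion (D r s lam mu) (r * conj mu) r := by
  have hr0 : 0 < r := hs.trans_lt hsr
  have habs : |r| < 1 := by rwa [abs_of_pos hr0]
  have hmem : (r : ℂ) ∈ ball (0 : ℂ) 1 := by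
    rwa [mem_ball_zero_iff, Complex.norm_real]
  have hnhds := isOpen_ball.mem_nhds hmem
  have hr' : (r : ℂ) ≠ 0 := by exact_mod_cast hr0.ne'
  have hsr' : ‖(s / r : ℂ)‖ < 1 := by
    rw [norm_div, Complex.norm_real, Complex.norm_real, Real.norm_of_nonneg hs,
      Real.norm_of_nonneg hr0.le]
    exact (div_lt_one hr0).2 hsr
  ext v
  constructor
  · rintro ⟨f, ⟨⟨hfd, hfm, hf0⟩, hfr, hf1, hf2⟩, rfl⟩
    obtain ⟨g, hgd, hgm, h⟩ := exists_schurRel (p := 0) (by simp) hfd hfm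
    rw [Complex.ofReal_zero, hf0] at h
    have hgr : g r = s / r := by
      rw [eq_div_iff hr', mul_comm, ← h.eq_mul hmem, hfr]
    have hgm' := mapsTo_ball_of_norm_lt hmem hgd hgm (hgr ▸ hsr')
    obtain ⟨g₁, hgd₁, hgm₁, h₀⟩ := exists_schurRel habs hgd hgm'
    rw [hgr] at h₀
    have hfa := hfd.analyticAt hnhds
    have hga := hgd.analyticAt hnhds
    have hga₁ := hgd₁.analyticAt hnhds
    have hg₁r : g₁ r = lam := by
      have := (deriv_of_schurRel hr0 hr hfa hga hga₁ h h₀).2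
      rw [hf1, add_right_inj] at this
      exact (mul_left_cancel₀ (ρ₁_ne_zero hs hsr hr) this).symm
    have hgm₁' := mapsTo_ball_of_norm_lt hmem hgd₁ hgm₁ (hg₁r ▸ hlam)
    obtain ⟨g₂, hgd₂, hgm₂, h₁⟩ := exists_schurRel habs hgd₁ hgm₁'
    rw [hg₁r] at h₁
    have hga₂ := hgd₂.analyticAt hnhds
    have hg₂r : g₂ r = mu := by
      have := iteratedDeriv_two_of_schurRel hr0 hr hfa hga hga₁ hga₂ h h₀ h₁
      rw [hf2, add_right_inj] at this
      exact (mul_left_cancel₀ (ρ₂_ne_zero hs hsr hr hlam) this).symm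
    have hgm₂' := mapsTo_ball_of_norm_lt hmem hgd₂ hgm₂ (hg₂r ▸ hmu)
    obtain ⟨g₃, hgd₃, hgm₃, h₂⟩ := exists_schurRel habs hgd₂ hgm₂'
    rw [hg₂r] at h₂
    have hga₃ := hgd₃.analyticAt hnhds
    obtain ⟨w, hw, hderiv⟩ := exists_deriv_eq habs hgd₃ hgm₃
    refine ⟨_, ⟨g₃ r, w, mem_closedBall_zero_iff.1 (hgm₃ hmem), hw, rfl⟩, ?_⟩
    rw [iteratedDeriv_four_of_schurRel hr0 hr hfa hga hga₁ hga₂ hga₃ h h₀ h₁ h₂, hderiv]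
    simp only [scale]
    ring
  · rintro ⟨_, ⟨ζ, w, hζ, hw, rfl⟩, rfl⟩
    obtain ⟨g₃, hgd₃, hgm₃, hg₃r, hderiv⟩ := exists_of_deriv_eq habs hζ hw
    obtain ⟨g₂, hgd₂, hgm₂, h₂⟩ := exists_schurRel_of_parameter habs hmu hgd₃ hgm₃
    obtain ⟨g₁, hgd₁, hgm₁, h₁⟩ := exists_schurRel_of_parameter habs hlam hgd₂
      (hgm₂.mono_right ball_subset_closedBall)
    obtain ⟨g, hgd, hgm, h₀⟩ := exists_schurRel_of_parameter habs hsr' hgd₁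
      (hgm₁.mono_right ball_subset_closedBall)
    obtain ⟨f, hfd, hfm, h⟩ := exists_schurRel_of_parameter (p := 0) (by simp)
      (b := 0) (by simp) hgd (hgm.mono_right ball_subset_closedBall)
    have hfa := hfd.analyticAt hnhds
    have hga := hgd.analyticAt hnhds
    have hga₁ := hgd₁.analyticAt hnhds
    have hga₂ := hgd₂.analyticAt hnhds
    have hga₃ := hgd₃.analyticAt hnhds
    obtain ⟨hfr, hf1⟩ := deriv_of_schurRel hr0 hr hfa hga hga₁ h h₀
    have hf2 := iteratedDeriv_two_of_schurRel hr0 hr hfa hga hga₁ hga₂ h h₀ h₁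
    have hf0 : f 0 = 0 := by rw [h.eq_mul (mem_ball_self one_pos), zero_mul]
    rw [(h₁.taylorCoeff_eq hmem hga₁ hga₂).1] at hf1
    rw [(h₂.taylorCoeff_eq hmem hga₂ hga₃).1] at hf2
    refine ⟨f, ⟨⟨hfd, hfm, hf0⟩, hfr, hf1, hf2⟩, ?_⟩
    rw [iteratedDeriv_four_of_schurRel hr0 hr hfa hga hga₁ hga₂ hga₃ h h₀ h₁ h₂, hderiv, hg₃r]
    simp only [scale]
    ring

/-! ### Affine images -/

/-- The affine homeomorphism `k ↦ a k + b` of the plane. -/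
noncomputable def affineHomeomorph (a b : ℂ) (ha : a ≠ 0) : ℂ ≃ₜ ℂ :=
  (Homeomorph.mulLeft₀ a ha).trans (Homeomorph.addRight b)

theorem affineHomeomorph_apply {a b : ℂ} (ha : a ≠ 0) (k : ℂ) :
    affineHomeomorph a b ha k = a * k + b := rfl

theorem isConvexClosedJordanDomain_image {K : Set ℂ} (hK : IsCompact K) (hc : Convex ℝ K)
    (hi : (interior K).Nonempty) {a : ℂ} (ha : a ≠ 0) (b : ℂ) :
    IsConvexClosedJordanDomain ((fun k => a * k + b) '' K) := by
  refine isConvexClosedJordanDomain_of_isCompact (hK.image (by fun_prop)) ?_ ?_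
  · rintro _ ⟨x, hx, rfl⟩ _ ⟨y, hy, rfl⟩ p q hp hq hpq
    refine ⟨p • x + q • y, hc hx hy hp hq hpq, ?_⟩
    have h : (p : ℂ) + q = 1 := by exact_mod_cast hpq
    simp only [Complex.real_smul]
    linear_combination -b * h
  · have := (affineHomeomorph a b ha).image_interior K
    have h2 : (affineHomeomorph a b ha : ℂ → ℂ) = fun k => a * k + b := rfl
    rw [h2] at this
    rw [← this]
    exact hi.image _

theorem IsParametrization.image {γ : ℝ → ℂ} {K : Set ℂ} (h : IsParametrization γ (frontier K))
    (e : ℂ ≃ₜ ℂ) : IsParametrization (fun θ => e (γ θ)) (frontier (e '' K)) where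
  continuous := e.continuous.comp h.continuous
  periodic := h.periodic.comp e
  bijOn := by
    rw [← e.image_frontier]
    exact (e.injective.injOn.bijOn_image).comp h.bijOn

/-- The phase of `d` is absorbed into `w`, so only `|d|` enters the radius. -/
theorem discUnion_eq_image {d b : ℂ} (hd : d ≠ 0) (x : ℝ) :
    discUnion d b x = (fun k => d * k) '' discUnion 1 (b / d) (x / ‖d‖) := by
  have hn : (‖d‖ : ℂ) ≠ 0 := by exact_mod_cast (norm_pos_iff.2 hd).ne'
  ext k
  constructor
  · rintro ⟨ζ, w, hζ, hw, rfl⟩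
    refine ⟨_, ⟨ζ, ‖d‖ / d * w, hζ, ?_, rfl⟩, ?_⟩
    · rwa [norm_mul, norm_div, Complex.norm_real, norm_norm, div_self (norm_ne_zero_iff.2 hd),
        one_mul]
    · push_cast
      field_simp
  · rintro ⟨_, ⟨ζ, w, hζ, hw, rfl⟩, rfl⟩
    refine ⟨ζ, d / ‖d‖ * w, hζ, ?_, ?_⟩
    · rwa [norm_mul, norm_div, Complex.norm_real, norm_norm, div_self (norm_ne_zero_iff.2 hd),
        one_mul]
    · push_cast
      field_simp

theorem norm_η_lt_t {r s : ℝ} {lam mu : ℂ} (hr0 : 0 < r) (hmu : ‖mu‖ < 1)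
    (hD : D r s lam mu ≠ 0) : ‖η r s lam mu‖ < t r s lam mu := by
  rw [η, t, norm_div, norm_mul, Complex.norm_real, Complex.norm_conj, Real.norm_of_nonneg hr0.le]
  exact div_lt_div_of_pos_right (mul_lt_of_lt_one_right hr0 hmu) (norm_pos_iff.2 hD)

theorem isConvexClosedJordanDomain_V {r s : ℝ} {lam mu : ℂ} (hs : 0 ≤ s) (hsr : s < r)
    (hr : r < 1) (hlam : ‖lam‖ < 1) (hmu : ‖mu‖ < 1) :
    IsConvexClosedJordanDomain (V r s lam mu) := by
  have hr0 : 0 < r := hs.trans_lt hsr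
  rw [V_eq_image hs hsr hr hlam hmu]
  refine isConvexClosedJordanDomain_image (isCompact_discUnion _ _ _) (convex_discUnion ?_)
    (interior_discUnion_nonempty _ _ hr0)
    (mul_ne_zero (A_ne_zero hs hsr hr) (scale_ne_zero hr0 hlam hmu)) _
  rw [norm_mul, Complex.norm_real, Complex.norm_conj, Real.norm_of_nonneg hr0.le]
  exact mul_lt_of_lt_one_right hr0 hmu

theorem isParametrization_circlePoint {r s : ℝ} {lam mu : ℂ} (hs : 0 ≤ s) (hsr : s < r)
    (hr : r < 1) (hlam : ‖lam‖ < 1) (hmu : ‖mu‖ < 1) (hD : D r s lam mu ≠ 0) {T : ℝ → ℝ}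
    (hT : ∀ θ, IsTTheta (η r s lam mu) (t r s lam mu) θ (T θ)) :
    IsParametrization
      (fun θ => circlePoint r s lam mu (zetaTheta (η r s lam mu) (T θ) θ) θ)
      (frontier (V r s lam mu)) := by
  have hr0 : 0 < r := hs.trans_lt hsr
  have ha : A r s * C r s lam mu ≠ 0 := mul_ne_zero (A_ne_zero hs hsr hr)
    (mul_ne_zero (scale_ne_zero hr0 hlam hmu) hD)
  have h := (isParametrization_exposedPoint (norm_η_lt_t hr0 hmu hD) hT).image
    (affineHomeomorph _ (A r s * B r s lam mu) ha)
  have hV : V r s lam mu = affineHomeomorph _ (A r s * B r s lam mu) ha ''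
      discUnion 1 (η r s lam mu) (t r s lam mu) := by
    rw [V_eq_image hs hsr hr hlam hmu, discUnion_eq_image hD, image_image]
    refine image_congr fun k _ => ?_
    rw [affineHomeomorph_apply, C, scale]
    ring
  rw [← hV] at h
  convert h using 2 with θ
  rw [affineHomeomorph_apply, circlePoint, exposedPoint]
  ring

theorem circlePoint_eq_centrePoint {r s : ℝ} {lam mu ζ : ℂ} (hζ : ‖ζ‖ = 1) (θ : ℝ) :
    circlePoint r s lam mu ζ θ = centrePoint r s lam mu ζ := by
  simp [circlePoint, centrePoint, ρ, hζ]

theorem abs_lhs_sub_le {η : ℂ} {t : ℝ} (ht : 0 ≤ t) (θ : ℝ) :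
    t - ‖η‖ ≤ lhs η t θ ∧ lhs η t θ ≤ t + ‖η‖ := by
  have h : ‖(t : ℂ) * Complex.exp (θ * Complex.I)‖ = t := by
    rw [norm_mul, Complex.norm_real, Real.norm_of_nonneg ht, Complex.norm_exp_ofReal_mul_I, mul_one]
  have h1 := norm_sub_norm_le ((t : ℂ) * Complex.exp (θ * Complex.I)) (conj η)
  have h2 := norm_sub_le ((t : ℂ) * Complex.exp (θ * Complex.I)) (conj η)
  rw [h, Complex.norm_conj] at h1 h2
  exact ⟨h1, h2⟩

/-- Factor `rhs` as `2 (t + |η|) (t - |η|)`: it is at most `t - |η|`, the least value the triangle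
inequality allows for `lhs`. -/
theorem rhs_le_lhs {η : ℂ} {t : ℝ} (ht : ‖η‖ < t) (h : t + ‖η‖ ≤ 1 / 2) (θ : ℝ) :
    rhs η t ≤ lhs η t θ := by
  refine le_trans ?_ (abs_lhs_sub_le ((norm_nonneg η).trans ht.le) θ).1
  rw [rhs]
  nlinarith

theorem lhs_le_rhs {η : ℂ} {t : ℝ} (ht : ‖η‖ < t) (h : 1 / 2 ≤ t - ‖η‖) (θ : ℝ) :
    lhs η t θ ≤ rhs η t := by
  refine le_trans (abs_lhs_sub_le ((norm_nonneg η).trans ht.le) θ).2 ?_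
  rw [rhs]
  nlinarith [norm_nonneg η]

end FourthDerivative

theorem theorem2 (r s : ℝ) (lam mu : ℂ) (hs : 0 ≤ s) (hsr : s < r) (hr : r < 1)
    (hlam : ‖lam‖ < 1) (hmu : ‖mu‖ < 1) :
    FourthDerivative.IsConvexClosedJordanDomain (FourthDerivative.V r s lam mu) ∧
    (FourthDerivative.D r s lam mu ≠ 0 →
      ∀ (η : ℂ) (t : ℝ), η = FourthDerivative.η r s lam mu → t = FourthDerivative.t r s lam mu →
        (∀ θ : ℝ, ∃! x : ℝ, FourthDerivative.IsTTheta η t θ x) ∧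
        ∀ (T : ℝ → ℝ) (ζ : ℝ → ℂ),
          (∀ θ, FourthDerivative.IsTTheta η t θ (T θ)) →
          (∀ θ, ζ θ = FourthDerivative.zetaTheta η (T θ) θ) →
          (∀ θ, ζ θ ∈ Metric.closedBall (0 : ℂ) 1) ∧
          (t + ‖η‖ ≤ 1 / 2 →
            (∀ θ, FourthDerivative.lhs η t θ ≥ FourthDerivative.rhs η t) ∧
            FourthDerivative.IsParametrization
              (fun θ => FourthDerivative.centrePoint r s lam mu (ζ θ))
              (frontier (FourthDerivative.V r s lam mu))) ∧
          (t - ‖η‖ ≥ 1 / 2 →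
            (∀ θ, FourthDerivative.lhs η t θ ≤ FourthDerivative.rhs η t) ∧
            FourthDerivative.IsParametrization
              (fun θ => FourthDerivative.circlePoint r s lam mu (ζ θ) θ)
              (frontier (FourthDerivative.V r s lam mu))) ∧
          (t + ‖η‖ > 1 / 2 → t - ‖η‖ < 1 / 2 →
            ∀ γ : ℝ → ℂ,
              (∀ θ, FourthDerivative.lhs η t θ < FourthDerivative.rhs η t →
                γ θ = FourthDerivative.circlePoint r s lam mu (ζ θ) θ) →
              (∀ θ, FourthDerivative.lhs η t θ ≥ FourthDerivative.rhs η t →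
                γ θ = FourthDerivative.centrePoint r s lam mu (ζ θ)) →
              FourthDerivative.IsParametrization γ
                (frontier (FourthDerivative.V r s lam mu)))) := by
  have hr0 : 0 < r := hs.trans_lt hsr
  refine ⟨FourthDerivative.isConvexClosedJordanDomain_V hs hsr hr hlam hmu, fun hD η t hη ht => ?_⟩
  have hlt : ‖η‖ < t := by
    rw [hη, ht]
    exact FourthDerivative.norm_η_lt_t hr0 hmu hD
  refine ⟨FourthDerivative.existsUnique_isTTheta hlt, fun T ζ hT hζ => ?_⟩
  -- One parametrization serves all three cases; `hone` rewrites it where `|ζ θ| = 1`.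
  have hpar : FourthDerivative.IsParametrization
      (fun θ => FourthDerivative.circlePoint r s lam mu (ζ θ) θ)
      (frontier (FourthDerivative.V r s lam mu)) := by
    have := FourthDerivative.isParametrization_circlePoint hs hsr hr hlam hmu hD
      (T := T) (by rwa [← hη, ← ht])
    rw [← hη] at this
    simpa only [hζ] using this
  have hone : ∀ θ, FourthDerivative.rhs η t ≤ FourthDerivative.lhs η t θ →
      FourthDerivative.circlePoint r s lam mu (ζ θ) θ =
        FourthDerivative.centrePoint r s lam mu (ζ θ) := by
    intro θ hle
    refine FourthDerivative.circlePoint_eq_centrePoint ?_ θ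
    rw [hζ]
    exact (hT θ).norm_zetaTheta_eq_one hle
  refine ⟨fun θ => ?_, fun h => ?_, fun h => ?_, fun _ _ γ h₁ h₂ => ?_⟩
  · rw [hζ, mem_closedBall_zero_iff]
    exact ((hT θ).spec hlt).2.1
  · have hall := FourthDerivative.rhs_le_lhs hlt h
    refine ⟨hall, ?_⟩
    simpa only [hone _ (hall _)] using hpar
  · exact ⟨FourthDerivative.lhs_le_rhs hlt h, hpar⟩
  · have hγ : γ = fun θ => FourthDerivative.circlePoint r s lam mu (ζ θ) θ := by
      funext θ
      rcases lt_or_ge (FourthDerivative.lhs η t θ) (FourthDerivative.rhs η t) with hlt' | hge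
      · exact h₁ θ hlt'
      · rw [h₂ θ hge, hone θ hge]
    rw [hγ]
    exact hpar
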